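/- Let $\mathbb P^1$ be covered by the two standard charts $\mathbb C_z$ and $\mathbb C_w$, $w=1/z$, and let $\mathbb D\subset\mathbb C$ be the open unit disc. Normalise $dd^c=\frac{i}{2\pi}\partial\bar\partial$, so that $dd^c\log|z|^2=\delta_0$, and let $\omega_{FS}$ be the Fubini–Study form, $\omega_{FS}=dd^c\log(1+|z|^2)$ on $\mathbb C_z$, so that $\int_{\mathbb P^1}\omega_{FS}=1$. Let $\pi:\mathbb P^1\times\overline{\mathbb D}\to\mathbb P^1$ be the projection. An arc in $\mathbb C$ is the image of an injective smooth map $[0,1]\to\mathbb C$. **Theorem 2.1.** Suppose that $\phi\in C^\infty(\mathbb P^1)$ is real-valued and satisfies 1. $\omega_{FS}+dd^c\phi>0$; 2. on $\mathbb C_w\subset\mathbb P^1$ one has $\phi\ge-\ln(1+|w|^2)$, and the set of points of $\mathbb C_w$ where equality holds is an arc in $\mathbb C_w$. For $\tau\in\partial\mathbb D$ put $\phi_\tau(z)=\phi(\tau z)$, and let $\Phi$ be the weak solution of the Dirichlet problem for the homogeneous Monge–Ampère equation $$\Phi(\cdot,\tau)=\phi_\tau\ (\tau\in\partial\mathbb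 D),\qquad \pi^*\omega_{FS}+dd^c\Phi\ge0,\qquad (\pi^*\omega_{FS}+dd^c\Phi)^2=0$$ on $\mathbb P^1\times\overline{\mathbb D}$, defined as the pointwise supremum of all upper semicontinuous $\psi:\mathbb P^1\times\overline{\mathbb D}\to\mathbb R\cup\{-\infty\}$ such that $\pi^*\omega_{FS}+dd^c\psi\ge0$ on $\mathbb P^1\times\mathbb D$ and $\psi(z,\tau)\le\phi(\tau z)$ for all $(z,\tau)\in\mathbb P^1\times\partial\mathbb D$. Then $\Phi$ does not have maximal rank: it is not true that for every $\tau\in\overline{\mathbb D}$ the current $\omega_{FS}+dd^c\Phi(\cdot,\tau)$ on $\mathbb P^1$ is strictly positive (that is, $\ge\varepsilon\,\omega_{FS}$ for some $\varepsilon>0$). In fact there is a non-empty open set $S\subset\mathbb P^1\times\mathbb D$ such that $\pi^*\omega_{FS}+dd^c\Phi=0$ on $S$ in the sense of currents. -/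

import Mathlib

open Set Metric MeasureTheory Filter Topology
open scoped ContDiff

noncomputable section

/-- The complex projective line `ℙ¹ = ℂ_z ∪ {∞}`, as the one-point compactification of `ℂ_z`. -/
abbrev P1 : Type := OnePoint ℂ

namespace P1

/-- The chart `ℂ_z → ℙ¹`. -/
def chartZ (z : ℂ) : P1 := (z : OnePoint ℂ)

/-- The chart `ℂ_w → ℙ¹`, where `w = 1 / z`; the point `w = 0` is `z = ∞`. -/
def chartW (w : ℂ) : P1 := if w = 0 then OnePoint.infty else ((w⁻¹ : ℂ) : OnePoint ℂ)

/-- The standard cover of `ℙ¹` by two charts. -/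
def charts : Set (ℂ → P1) := {chartZ, chartW}

/-- Smooth real functions on `ℙ¹` (that is, smooth in both charts). -/
def Smooth (φ : P1 → ℝ) : Prop := ∀ κ ∈ charts, ContDiff ℝ ∞ (fun ζ => φ (κ ζ))

/-- The map `z ↦ τ z` of `ℙ¹` (used for `|τ| = 1`); it fixes `0` and `∞`. -/
def rot (τ : ℂ) : P1 → P1 := OnePoint.map (fun z => τ * z)

/-- The local potential `log (1 + |ζ|²)` of the Fubini-Study form, which is the same in the
coordinate `z` and in the coordinate `w`. -/
def fsPotential (ζ : ℂ) : ℝ := Real.log (1 + ‖ζ‖ ^ 2)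

end P1

/-- An arc in `ℂ`: the image of a smooth map `[0,1] → ℂ` without self-intersections. -/
def IsArc (A : Set ℂ) : Prop :=
  ∃ γ : ℝ → ℂ, ContDiffOn ℝ ∞ γ (Icc 0 1) ∧ InjOn γ (Icc 0 1) ∧ A = γ '' Icc 0 1

/-- For smooth `χ`, the form `dd^c χ` at `p` in the direction `b`: the density, at `ζ = 0` and with
respect to `dx ∧ dy`, of the pull-back of `dd^c χ` to the complex line `ζ ↦ p + ζ b`.
The normalisation is `dd^c = (i / 2π) ∂∂̄`, so that `dd^c log |z|² = δ₀`; on `ℂ` this means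
`dd^c u = (1 / 4π) (Δ u) dx ∧ dy`. In coordinates `ddc χ p b = (1/π) ∑ (∂²χ/∂z_j∂z̄_k)(p) b_j b̄_k`, so
the numbers `ddc χ p b`, for all `b`, determine `dd^c χ` at `p`. -/
def ddc {E : Type*} [NormedAddCommGroup E] [NormedSpace ℂ E] (χ : E → ℝ) (p b : E) : ℝ :=
  (1 / (4 * Real.pi)) * Laplacian.laplacian (fun ζ : ℂ => χ (p + ζ • b)) 0

/-- Plurisubharmonic functions on an open set `U`, with values in `ℝ ∪ {-∞}` (the constant `-∞` is
allowed): upper semicontinuous, with the sub-mean-value inequality on every closed complex disc in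
`U`. The mean over the circle of an upper semicontinuous function `v < +∞` is the infimum of the
means of its continuous majorants `g`, and the inequality is written in that form. -/
def PlurisubharmonicOn {E : Type*} [NormedAddCommGroup E] [NormedSpace ℂ E]
    (u : E → EReal) (U : Set E) : Prop :=
  UpperSemicontinuousOn u U ∧ (∀ p ∈ U, u p ≠ ⊤) ∧
    ∀ a b : E, (∀ ζ ∈ closedBall (0 : ℂ) 1, a + ζ • b ∈ U) →
      ∀ g : ℂ → ℝ, ContinuousOn g (sphere 0 1) →
        (∀ ζ ∈ sphere (0 : ℂ) 1, u (a + ζ • b) ≤ (g ζ : EReal)) →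
          u a ≤ ((Real.circleAverage g 0 1 : ℝ) : EReal)

namespace HMAE

open P1

/-- `ω_FS + dd^c φ > 0` for smooth `φ` on `ℙ¹`. -/
def IsKahlerPotential (φ : P1 → ℝ) : Prop :=
  ∀ κ ∈ charts, ∀ ζ : ℂ, 0 < ddc (fun ξ => fsPotential ξ + φ (κ ξ)) ζ 1

/-- `π^* ω_FS + dd^c ψ ≥ 0` on `ℙ¹ × 𝔻`: adding to `ψ` a local potential of `ω_FS` gives a
plurisubharmonic function. -/
def IsOmegaPsh (ψ : P1 × ℂ → EReal) : Prop :=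
  ∀ κ ∈ charts, PlurisubharmonicOn
    (fun q : ℂ × ℂ => (fsPotential q.1 : EReal) + ψ (κ q.1, q.2)) (univ ×ˢ ball 0 1)

/-- The competitors in the Dirichlet problem on `ℙ¹ × 𝔻̄` with boundary data `F (·, τ)`, `|τ| = 1`.
Only the values of `ψ` on `ℙ¹ × 𝔻̄` play a role. -/
def IsCandidate (F : P1 × ℂ → ℝ) (ψ : P1 × ℂ → EReal) : Prop :=
  UpperSemicontinuousOn ψ (univ ×ˢ closedBall 0 1) ∧
    (∀ p ∈ (univ ×ˢ closedBall 0 1 : Set (P1 × ℂ)), ψ p ≠ ⊤) ∧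
    IsOmegaPsh ψ ∧
    ∀ z : P1, ∀ τ ∈ sphere (0 : ℂ) 1, ψ (z, τ) ≤ (F (z, τ) : EReal)

/-- The weak solution on `ℙ¹ × 𝔻̄` of the homogeneous Monge-Ampère equation
`(π^* ω_FS + dd^c Φ)² = 0`, `π^* ω_FS + dd^c Φ ≥ 0`, with boundary data `F (·, τ)` for `|τ| = 1`:
the upper envelope of all competitors. (Only its values on `ℙ¹ × 𝔻̄` are meaningful.) -/
def weakSolution (F : P1 × ℂ → ℝ) (p : P1 × ℂ) : EReal :=
  ⨆ (ψ : P1 × ℂ → EReal) (_ : IsCandidate F ψ), ψ p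

/-- `π^* ω_FS + dd^c Φ = 0` on the open set `S`, in the sense of currents: in each chart the function
`u = log (1 + |ζ|²) + Φ` is (almost everywhere finite and) locally integrable, and the distribution
`dd^c u` vanishes. A test form of bidegree `(1,1)` is a combination of a smooth compactly
supported function `χ` times constant forms, so that `⟨dd^c u, ·⟩` is given by the numbers
`∫ u · ddc χ · b`, for all `χ` and all directions `b`. -/
def CurrentVanishesOn (Φ : P1 × ℂ → EReal) (S : Set (P1 × ℂ)) : Prop :=
  ∀ κ ∈ charts,
    (∀ᵐ q : ℂ × ℂ, (κ q.1, q.2) ∈ S → Φ (κ q.1, q.2) ≠ ⊤ ∧ Φ (κ q.1, q.2) ≠ ⊥) ∧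
    LocallyIntegrableOn (fun q : ℂ × ℂ => fsPotential q.1 + (Φ (κ q.1, q.2)).toReal)
      {q : ℂ × ℂ | (κ q.1, q.2) ∈ S} ∧
    ∀ χ : ℂ × ℂ → ℝ, ContDiff ℝ ∞ χ → HasCompactSupport χ →
      tsupport χ ⊆ {q : ℂ × ℂ | (κ q.1, q.2) ∈ S} →
      ∀ b : ℂ × ℂ,
        ∫ q : ℂ × ℂ, (fsPotential q.1 + (Φ (κ q.1, q.2)).toReal) * ddc χ q b = 0

/-- The current `ω_FS + dd^c h` on `ℙ¹` is strictly positive: `ω_FS + dd^c h ≥ ε ω_FS` for some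
`ε > 0`, tested in each chart against smooth compactly supported functions `χ ≥ 0`. -/
def StrictlyPositive (h : P1 → EReal) : Prop :=
  ∃ ε : ℝ, 0 < ε ∧ ∀ κ ∈ charts, ∀ χ : ℂ → ℝ, ContDiff ℝ ∞ χ → HasCompactSupport χ →
    (∀ ζ, 0 ≤ χ ζ) →
      0 ≤ ∫ ζ : ℂ, ((1 - ε) * fsPotential ζ + (h (κ ζ)).toReal) * ddc χ ζ 1

/-- `π^* ω_FS + dd^c Φ` has maximal rank in the fibre directions: the current
`ω_FS + dd^c Φ (·, τ)` is strictly positive for every `τ ∈ 𝔻̄`. -/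
def HasMaximalRank (Φ : P1 × ℂ → EReal) : Prop :=
  ∀ τ ∈ closedBall (0 : ℂ) 1, StrictlyPositive (fun z => Φ (z, τ))

end HMAE

end

/-! The function -log(1+|w|²) is a competitor: adding the local potential gives 0 in the chart w and
log|z|² in the chart z, so its only curvature sits over z = 0. Hence Φ is at least this function,
and the current vanishes on any open set off z = 0 where the two agree. It remains to prove the
reverse inequality on an open set close to (w, τ) = (0, 0).

Let ψ be a competitor and U = log(1+|w|²) + ψ, plurisubharmonic on ℂ × 𝔻 in the coordinates (w, τ).
If A is the contact arc, the boundary condition gives U(τa, τ) ≤ 0 for a in A and |τ| = 1, hence for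
|τ| ≤ 1 by the maximum principle. To leave these discs, put v = w/τ and, for ε > 0, consider s(v) =
sup {-2 log|τ| : U(τv, τ) ≥ ε}. In the manner of Hartogs, s behaves like a subharmonic function
where it is positive; it is -∞ on A, and it grows at most like log|v|² because U(0, 0) ≤ 0. The arc
is not polar: it carries a measure whose logarithmic potential p is harmonic off A, bounded below by
some m, and grows like log|v|². Comparison gives s ≤ p - m, and the upper bound for p turns this
into U ≤ 0 for |w| + R₀|τ| < exp(m/2), τ ≠ 0. The region does not depend on ψ, so Φ = -log(1+|w|²)
there.

The main steps are `PlurisubharmonicOn.lt_on_disc`, `IsArc.exists_logPotential`,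
`IsArc.exists_nonpos_region` and `HMAE.exists_weakSolution_eq`. -/

/-! ### Maximum principle along holomorphic discs -/

/-- Mean value property for the real part of a holomorphic function on a disc. -/
lemma circleAverage_re_eq {B : ℂ → ℂ} {V : Set ℂ} (hB : DifferentiableOn ℂ B V)
    (hV : closedBall (0 : ℂ) 1 ⊆ V) :
    Real.circleAverage (fun ξ => (B ξ).re) 0 1 = (B 0).re := by
  have h1 : DiffContOnCl ℂ B (ball 0 |1|) := by
    rw [abs_one]
    exact hB.diffContOnCl_ball hV
  have h2 := h1.circleAverage
  have h3 := Complex.reCLM.circleAverage_comp_comm (f := B) (c := 0) (R := 1)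
    ((hB.continuousOn.mono (by simpa using sphere_subset_closedBall.trans hV)).circleIntegrable' )
  rw [h2] at h3
  exact h3

lemma sq_norm_sub_le_of_norm_le (d q : ℂ) {k : ℝ} (hq : ‖q‖ ≤ k) :
    ‖d - q‖ ^ 2 ≤ ‖d‖ ^ 2 - 2 * ((starRingEnd ℂ) d * q).re + k ^ 2 := by
  have h : ‖d - q‖ ^ 2 = ‖d‖ ^ 2 - 2 * ((starRingEnd ℂ) d * q).re + ‖q‖ ^ 2 := by
    rw [Complex.sq_norm, Complex.sq_norm, Complex.sq_norm, Complex.normSq_sub]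
    simp [Complex.mul_re]
    ring
  rw [h]
  gcongr

lemma sq_norm_add_real_mul (x y : ℂ) (hy : ‖y‖ = 1) (s : ℝ) :
    ‖x + s * y‖ ^ 2 = ‖x‖ ^ 2 + 2 * ((starRingEnd ℂ) x * (s * y)).re + s ^ 2 := by
  have h2 : ‖y‖ ^ 2 = 1 := by rw [hy]; norm_num
  rw [Complex.sq_norm, Complex.normSq_apply] at *
  rw [Complex.sq_norm, Complex.normSq_apply]
  simp [Complex.mul_re]
  nlinarith [h2]

/-- A real function with the sub-mean-value inequality on complex discs cannot be touched from above
by `N ‖p - f ζ‖² - η ‖ζ - c‖²` (as a function of `p` and `ζ`), for holomorphic `f`. -/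
lemma not_touching {v : ℂ × ℂ → ℝ} {Ω : Set (ℂ × ℂ)} (hΩ : IsOpen Ω)
    (hsub : ∀ a b : ℂ × ℂ, (∀ ζ ∈ closedBall (0 : ℂ) 1, a + ζ • b ∈ Ω) →
      ∀ g : ℂ → ℝ, ContinuousOn g (sphere 0 1) →
        (∀ ζ ∈ sphere (0 : ℂ) 1, v (a + ζ • b) ≤ g ζ) → v a ≤ Real.circleAverage g 0 1)
    {f₁ f₂ : ℂ → ℂ} {W : Set ℂ} (hW : IsOpen W) (h₁ : DifferentiableOn ℂ f₁ W)
    (h₂ : DifferentiableOn ℂ f₂ W) {ζ₀ c : ℂ} (hζ₀ : ζ₀ ∈ W) {p₀ : ℂ × ℂ} (hp₀ : p₀ ∈ Ω)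
    {N η : ℝ} (hN : 0 < N) (hη : 0 < η)
    (hmax : ∀ᶠ q : ℂ × (ℂ × ℂ) in 𝓝 (ζ₀, p₀),
      v q.2 - N * (‖q.2.1 - f₁ q.1‖ ^ 2 + ‖q.2.2 - f₂ q.1‖ ^ 2) + η * ‖q.1 - c‖ ^ 2 ≤
        v p₀ - N * (‖p₀.1 - f₁ ζ₀‖ ^ 2 + ‖p₀.2 - f₂ ζ₀‖ ^ 2) + η * ‖ζ₀ - c‖ ^ 2) : False := by
  -- Moving ζ by t and p by t b changes p - f(ζ) only by o(t). With Taylor error at most κs on the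
  -- circle |t| = s, the quadratic error costs at most 2Nκ²s², less than the gain ηs².
  set b : ℂ × ℂ := (deriv f₁ ζ₀, deriv f₂ ζ₀) with hb
  obtain ⟨κ, hκ, hκη⟩ : ∃ κ : ℝ, 0 < κ ∧ N * (2 * κ ^ 2) < η := by
    refine ⟨√(η / (4 * N)), by positivity, ?_⟩
    rw [Real.sq_sqrt (by positivity)]
    field_simp
    linarith
  have hd₁ := (h₁.differentiableAt (hW.mem_nhds hζ₀)).hasDerivAt
  have hd₂ := (h₂.differentiableAt (hW.mem_nhds hζ₀)).hasDerivAt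
  have ho₁ := (hasDerivAt_iff_isLittleO.1 hd₁).bound hκ
  have ho₂ := (hasDerivAt_iff_isLittleO.1 hd₂).bound hκ
  have hcont : Tendsto (fun t : ℂ => ((ζ₀ + t, p₀ + t • b) : ℂ × (ℂ × ℂ))) (𝓝 0) (𝓝 (ζ₀, p₀)) := by
    have : Continuous (fun t : ℂ => ((ζ₀ + t, p₀ + t • b) : ℂ × (ℂ × ℂ))) := by fun_prop
    simpa using this.tendsto 0
  have hcont1 : Tendsto (fun t : ℂ => ζ₀ + t) (𝓝 0) (𝓝 ζ₀) := by
    have : Continuous (fun t : ℂ => ζ₀ + t) := by fun_prop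
    simpa using this.tendsto 0
  have hcont2 : Tendsto (fun t : ℂ => p₀ + t • b) (𝓝 0) (𝓝 p₀) := by
    have : Continuous (fun t : ℂ => p₀ + t • b) := by fun_prop
    simpa using this.tendsto 0
  have hall := (((hcont.eventually hmax).and (hcont1.eventually (ho₁.and ho₂))).and
    ((hcont1.eventually (hW.mem_nhds hζ₀)).and (hcont2.eventually (hΩ.mem_nhds hp₀))))
  obtain ⟨ρ, hρ, hball⟩ := Metric.eventually_nhds_iff.1 hall
  set s : ℝ := ρ / 2 with hs
  have hs0 : 0 < s := by positivity
  have hsmall : ∀ ξ ∈ closedBall (0 : ℂ) 1, dist ((s : ℂ) * ξ) 0 < ρ := by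
    intro ξ hξ
    rw [mem_closedBall_zero_iff] at hξ
    rw [dist_zero_right, norm_mul, Complex.norm_real, Real.norm_of_nonneg hs0.le]
    nlinarith
  set q₁ : ℂ → ℂ := fun ξ => f₁ (ζ₀ + s * ξ) - f₁ ζ₀ - (s * ξ) * deriv f₁ ζ₀ with hq₁
  set q₂ : ℂ → ℂ := fun ξ => f₂ (ζ₀ + s * ξ) - f₂ ζ₀ - (s * ξ) * deriv f₂ ζ₀ with hq₂
  set d₁ := p₀.1 - f₁ ζ₀ with hd₁'
  set d₂ := p₀.2 - f₂ ζ₀ with hd₂'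
  -- The real part of `B` majorises v on the circle. Its non-constant terms are holomorphic and
  -- vanish at the centre, so the mean is the constant term, which is below v p₀.
  set B : ℂ → ℂ := fun ξ => ((v p₀ + N * (2 * (κ * s) ^ 2) - η * s ^ 2 : ℝ) : ℂ) -
    (2 * N : ℝ) * ((starRingEnd ℂ) d₁ * q₁ ξ + (starRingEnd ℂ) d₂ * q₂ ξ) -
    (2 * η : ℝ) * ((starRingEnd ℂ) (ζ₀ - c) * (s * ξ)) with hB
  set V : Set ℂ := (fun ξ : ℂ => ζ₀ + s * ξ) ⁻¹' W with hV
  have hV1 : closedBall (0 : ℂ) 1 ⊆ V := fun ξ hξ => (hball (hsmall ξ hξ)).2.1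
  have hin : DifferentiableOn ℂ (fun ξ : ℂ => ζ₀ + s * ξ) V := by fun_prop
  have hc₁ : DifferentiableOn ℂ (fun ξ : ℂ => f₁ (ζ₀ + s * ξ)) V := h₁.comp hin (fun _ h => h)
  have hc₂ : DifferentiableOn ℂ (fun ξ : ℂ => f₂ (ζ₀ + s * ξ)) V := h₂.comp hin (fun _ h => h)
  have hBd : DifferentiableOn ℂ B V := by
    have g₁ : DifferentiableOn ℂ q₁ V := (hc₁.sub_const _).sub (by fun_prop)
    have g₂ : DifferentiableOn ℂ q₂ V := (hc₂.sub_const _).sub (by fun_prop)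
    exact ((((g₁.const_mul _).add (g₂.const_mul _)).const_mul _).const_sub _).sub
      (((differentiableOn_id.const_mul _).const_mul _).const_mul _)
  have key := hsub p₀ ((s : ℂ) • b) (fun ξ hξ => by
      have := (hball (hsmall ξ hξ)).2.2
      rwa [mul_comm, mul_smul] at this) (fun ξ => (B ξ).re)
      (Complex.continuous_re.comp_continuousOn
        (hBd.continuousOn.mono (sphere_subset_closedBall.trans hV1))) (fun ξ hξ => by
      have hξ1 : ‖ξ‖ = 1 := by simpa using hξ
      obtain ⟨⟨hm, ho1, ho2⟩, -, -⟩ := hball (hsmall ξ (sphere_subset_closedBall hξ))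
      have e0 : p₀ + ξ • (s : ℂ) • b = p₀ + ((s : ℂ) * ξ) • b := by
        rw [mul_comm, mul_smul]
      rw [e0]
      have a1 : ‖q₁ ξ‖ ≤ κ * s := by
        simpa [hξ1, abs_of_pos hs0, hq₁] using ho1
      have a2 : ‖q₂ ξ‖ ≤ κ * s := by
        simpa [hξ1, abs_of_pos hs0, hq₂] using ho2
      have i1 := sq_norm_sub_le_of_norm_le d₁ _ a1
      have i2 := sq_norm_sub_le_of_norm_le d₂ _ a2
      have i3 := sq_norm_add_real_mul (ζ₀ - c) ξ hξ1 s
      have j1 : (p₀ + ((s : ℂ) * ξ) • b).1 - f₁ (ζ₀ + s * ξ) = d₁ - q₁ ξ := by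
        simp [hb, hq₁, hd₁']; ring
      have j2 : (p₀ + ((s : ℂ) * ξ) • b).2 - f₂ (ζ₀ + s * ξ) = d₂ - q₂ ξ := by
        simp [hb, hq₂, hd₂']; ring
      have j3 : ζ₀ + s * ξ - c = ζ₀ - c + s * ξ := by ring
      simp only [j1, j2, j3, i3] at hm
      have e1 : (B ξ).re = v p₀ + N * (2 * (κ * s) ^ 2) - η * s ^ 2 -
          2 * N * (((starRingEnd ℂ) d₁ * q₁ ξ).re + ((starRingEnd ℂ) d₂ * q₂ ξ).re) -
          2 * η * ((starRingEnd ℂ) (ζ₀ - c) * (s * ξ)).re := by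
        simp only [hB, Complex.sub_re, Complex.re_ofReal_mul, Complex.ofReal_re, Complex.add_re]
      rw [e1]
      have := mul_le_mul_of_nonneg_left (add_le_add i1 i2) hN.le
      nlinarith)
  rw [circleAverage_re_eq hBd hV1] at key
  have e1 : (B 0).re = v p₀ + N * (2 * (κ * s) ^ 2) - η * s ^ 2 := by
    have z1 : q₁ 0 = 0 := by simp [hq₁]
    have z2 : q₂ 0 = 0 := by simp [hq₂]
    simp only [hB, z1, z2, mul_zero, add_zero, sub_zero, Complex.ofReal_re]
  rw [e1] at key
  nlinarith [mul_pos hs0 hs0]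

/-- Maximum principle along holomorphic discs, for real-valued functions. -/
lemma le_on_disc_of_le_on_sphere {v : ℂ × ℂ → ℝ} {Ω : Set (ℂ × ℂ)} (hΩ : IsOpen Ω)
    (husc : UpperSemicontinuousOn v Ω)
    (hsub : ∀ a b : ℂ × ℂ, (∀ ζ ∈ closedBall (0 : ℂ) 1, a + ζ • b ∈ Ω) →
      ∀ g : ℂ → ℝ, ContinuousOn g (sphere 0 1) →
        (∀ ζ ∈ sphere (0 : ℂ) 1, v (a + ζ • b) ≤ g ζ) → v a ≤ Real.circleAverage g 0 1)
    {f₁ f₂ : ℂ → ℂ} {W : Set ℂ} (hW : IsOpen W) (h₁ : DifferentiableOn ℂ f₁ W)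
    (h₂ : DifferentiableOn ℂ f₂ W) {c : ℂ} {r : ℝ} (hr : 0 < r) (hball : closedBall c r ⊆ W)
    (hmaps : ∀ ζ ∈ closedBall c r, (f₁ ζ, f₂ ζ) ∈ Ω) {M : ℝ}
    (hM : ∀ ζ ∈ sphere c r, v (f₁ ζ, f₂ ζ) ≤ M) :
    ∀ ζ ∈ closedBall c r, v (f₁ ζ, f₂ ζ) ≤ M := by
  -- The sub-mean-value inequality is available only on affine discs. So the point p is freed from
  -- the curve f(ζ) and held near it by a penalty N‖p - f(ζ)‖²; a maximum of the penalised function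
  -- contradicts `not_touching`.
  intro ζ₁ hζ₁
  by_contra! hlt
  obtain ⟨θ, hθ, hMθ⟩ : ∃ θ : ℝ, 0 < θ ∧ M + 3 * θ ≤ v (f₁ ζ₁, f₂ ζ₁) :=
    ⟨(v (f₁ ζ₁, f₂ ζ₁) - M) / 3, by linarith, by linarith⟩
  have hfc : ContinuousOn (fun ζ => (f₁ ζ, f₂ ζ)) (closedBall c r) :=
    (h₁.continuousOn.mono hball).prodMk (h₂.continuousOn.mono hball)
  have hKc := (isCompact_closedBall c r).image_of_continuousOn hfc
  have hSc := (isCompact_sphere c r).image_of_continuousOn (hfc.mono sphere_subset_closedBall)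
  obtain ⟨δ₁, hδ₁, hT₁⟩ := hKc.exists_cthickening_subset_open hΩ (by
    rintro _ ⟨ζ, hζ, rfl⟩; exact hmaps ζ hζ)
  have hO : IsOpen (interior {p | v p < M + θ}) := isOpen_interior
  obtain ⟨δ₂, hδ₂, hT₂⟩ := hSc.exists_cthickening_subset_open hO (by
    rintro _ ⟨ζ, hζ, rfl⟩
    have hm := hmaps ζ (sphere_subset_closedBall hζ)
    have := husc _ hm (M + θ) (by linarith [hM ζ hζ])
    rw [hΩ.nhdsWithin_eq hm] at this
    exact mem_interior_iff_mem_nhds.2 this)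
  set δ := min δ₁ δ₂ with hδdef
  have hδ : 0 < δ := lt_min hδ₁ hδ₂
  set Kc := (fun ζ => (f₁ ζ, f₂ ζ)) '' closedBall c r with hKdef
  set T := cthickening δ Kc with hTdef
  have hTΩ : T ⊆ Ω := (cthickening_mono (min_le_left _ _) _).trans hT₁
  have hTc : IsCompact T := hKc.cthickening
  set X := closedBall c r ×ˢ T with hX
  have hXc : IsCompact X := (isCompact_closedBall c r).prod hTc
  -- The convex term is then at most θ on the disc, so a maximiser still has v p₀ ≥ M + 2θ, against
  -- v < M + θ near the boundary curve.
  set η := θ / r ^ 2 with hηdef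
  have hη : 0 < η := by positivity
  have hηr : η * r ^ 2 = θ := by rw [hηdef]; field_simp
  obtain ⟨C, hC⟩ : ∃ C, ∀ p ∈ T, v p ≤ C := by
    obtain ⟨C, hC⟩ := (husc.mono hTΩ).bddAbove_of_isCompact hTc
    exact ⟨C, fun p hp => hC ⟨p, hp, rfl⟩⟩
  -- Since v ≤ C on `T`, this size of N forces a maximiser to lie within δ of the curve.
  obtain ⟨N, hN, hNC⟩ : ∃ N : ℝ, 0 < N ∧ C - M - 2 * θ < N * δ ^ 2 := by
    refine ⟨(|C - M - 2 * θ| + 1) / δ ^ 2, by positivity, ?_⟩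
    rw [div_mul_cancel₀ _ (by positivity)]
    linarith [le_abs_self (C - M - 2 * θ)]
  have hqd : ∀ ζ ∈ closedBall c r, η * ‖ζ - c‖ ^ 2 ≤ θ := by
    intro ζ hζ
    rw [← hηr]
    have : ‖ζ - c‖ ≤ r := by simpa [dist_eq_norm] using hζ
    gcongr
  set H : ℂ × (ℂ × ℂ) → ℝ := fun q =>
    v q.2 + (- N * (‖q.2.1 - f₁ q.1‖ ^ 2 + ‖q.2.2 - f₂ q.1‖ ^ 2) + η * ‖q.1 - c‖ ^ 2) with hH
  have hHusc : UpperSemicontinuousOn H X := by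
    refine UpperSemicontinuousOn.add ?_ (ContinuousOn.upperSemicontinuousOn ?_)
    · exact husc.comp (g := fun q : ℂ × (ℂ × ℂ) => q.2) continuousOn_snd (fun q hq => hTΩ hq.2)
    · have g₁ : ContinuousOn (fun q : ℂ × (ℂ × ℂ) => f₁ q.1) X :=
        (h₁.continuousOn.mono hball).comp continuousOn_fst (fun q hq => hq.1)
      have g₂ : ContinuousOn (fun q : ℂ × (ℂ × ℂ) => f₂ q.1) X :=
        (h₂.continuousOn.mono hball).comp continuousOn_fst (fun q hq => hq.1)
      have l₁ : ContinuousOn (fun q : ℂ × (ℂ × ℂ) => q.2.1) X := by fun_prop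
      have l₂ : ContinuousOn (fun q : ℂ × (ℂ × ℂ) => q.2.2) X := by fun_prop
      have l₃ : ContinuousOn (fun q : ℂ × (ℂ × ℂ) => q.1 - c) X := by fun_prop
      exact (continuousOn_const.mul (((l₁.sub g₁).norm.pow 2).add ((l₂.sub g₂).norm.pow 2))).add
        (continuousOn_const.mul (l₃.norm.pow 2))
  have hp₁ : (f₁ ζ₁, f₂ ζ₁) ∈ T := self_subset_cthickening _ ⟨ζ₁, hζ₁, rfl⟩
  obtain ⟨⟨ζ₀, p₀⟩, ⟨hζ₀, hp₀⟩, hmax⟩ := hHusc.exists_isMaxOn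
    (show X.Nonempty from ⟨(ζ₁, (f₁ ζ₁, f₂ ζ₁)), ⟨hζ₁, hp₁⟩⟩) hXc
  have hge : M + 3 * θ ≤ H (ζ₀, p₀) := by
    have h := hmax (show (ζ₁, (f₁ ζ₁, f₂ ζ₁)) ∈ X from ⟨hζ₁, hp₁⟩)
    refine le_trans ?_ h
    simp only [hH, sub_self, norm_zero]
    nlinarith [sq_nonneg ‖ζ₁ - c‖]
  simp only [hH] at hge
  have hvC := hC p₀ hp₀
  have hq0 := hqd ζ₀ hζ₀
  have hlt : N * (‖p₀.1 - f₁ ζ₀‖ ^ 2 + ‖p₀.2 - f₂ ζ₀‖ ^ 2) < N * δ ^ 2 := by linarith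
  have hlt' := lt_of_mul_lt_mul_left hlt hN.le
  have hdist : dist p₀ (f₁ ζ₀, f₂ ζ₀) < δ := by
    rw [Prod.dist_eq, max_lt_iff, dist_eq_norm, dist_eq_norm]
    constructor
    · exact lt_of_pow_lt_pow_left₀ 2 hδ.le (by nlinarith [sq_nonneg ‖p₀.2 - f₂ ζ₀‖])
    · exact lt_of_pow_lt_pow_left₀ 2 hδ.le (by nlinarith [sq_nonneg ‖p₀.1 - f₁ ζ₀‖])
  have hint : ζ₀ ∈ ball c r := by
    by_contra hns
    have hs : ζ₀ ∈ sphere c r := by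
      rw [mem_sphere]
      exact le_antisymm hζ₀ (not_lt.1 hns)
    have hmem : p₀ ∈ cthickening δ₂ ((fun ζ => (f₁ ζ, f₂ ζ)) '' sphere c r) :=
      mem_cthickening_of_dist_le _ _ _ _ ⟨ζ₀, hs, rfl⟩ (hdist.le.trans (min_le_right _ _))
    have hv : p₀ ∈ {p | v p < M + θ} := interior_subset (hT₂ hmem)
    rw [mem_ofPred_eq] at hv
    have : 0 ≤ N * (‖p₀.1 - f₁ ζ₀‖ ^ 2 + ‖p₀.2 - f₂ ζ₀‖ ^ 2) := by positivity
    linarith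
  have hth : p₀ ∈ thickening δ Kc :=
    mem_thickening_iff.2 ⟨_, ⟨ζ₀, hζ₀, rfl⟩, hdist⟩
  refine not_touching hΩ hsub hW h₁ h₂ (c := c) (hball hζ₀) (hTΩ hp₀) hN hη ?_
  filter_upwards [(isOpen_ball.prod isOpen_thickening).mem_nhds
    (show (ζ₀, p₀) ∈ ball c r ×ˢ thickening δ Kc from ⟨hint, hth⟩)] with q hq
  have h := hmax (show q ∈ X from ⟨ball_subset_closedBall hq.1,
    thickening_subset_cthickening _ _ hq.2⟩)
  simp only [hH, mem_ofPred_eq] at h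
  linarith

/-- Maximum principle along holomorphic discs for plurisubharmonic functions. -/
lemma PlurisubharmonicOn.le_on_disc {u : ℂ × ℂ → EReal} {Ω : Set (ℂ × ℂ)} (hΩ : IsOpen Ω)
    (hu : PlurisubharmonicOn u Ω)
    {f₁ f₂ : ℂ → ℂ} {W : Set ℂ} (hW : IsOpen W) (h₁ : DifferentiableOn ℂ f₁ W)
    (h₂ : DifferentiableOn ℂ f₂ W) {c : ℂ} {r : ℝ} (hr : 0 < r) (hball : closedBall c r ⊆ W)
    (hmaps : ∀ ζ ∈ closedBall c r, (f₁ ζ, f₂ ζ) ∈ Ω) {M : ℝ}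
    (hM : ∀ ζ ∈ sphere c r, u (f₁ ζ, f₂ ζ) ≤ M) :
    ∀ ζ ∈ closedBall c r, u (f₁ ζ, f₂ ζ) ≤ M := by
  obtain ⟨husc, htop, hsub⟩ := hu
  -- Truncating below at M removes the value -∞ and preserves the sub-mean-value inequality and the
  -- boundary bound.
  set v : ℂ × ℂ → ℝ := fun p => (max (u p) (M : EReal)).toReal with hv
  have hcoe : ∀ p ∈ Ω, (v p : EReal) = max (u p) M := by
    intro p hp
    apply EReal.coe_toReal
    · exact (max_lt (lt_top_iff_ne_top.2 (htop p hp)) (EReal.coe_lt_top M)).ne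
    · exact ((EReal.bot_lt_coe M).trans_le (le_max_right _ _)).ne'
  have huv : ∀ p ∈ Ω, u p ≤ v p := fun p hp => by rw [hcoe p hp]; exact le_max_left _ _
  have hMv : ∀ p ∈ Ω, M ≤ v p := fun p hp => by
    rw [← EReal.coe_le_coe_iff, hcoe p hp]; exact le_max_right _ _
  have hv_usc : UpperSemicontinuousOn v Ω := by
    intro p hp y hy
    rw [← EReal.coe_lt_coe_iff, hcoe p hp] at hy
    filter_upwards [husc p hp y ((le_max_left _ _).trans_lt hy), self_mem_nhdsWithin] with q hq hqΩ
    rw [← EReal.coe_lt_coe_iff, hcoe q hqΩ]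
    exact max_lt hq ((le_max_right _ _).trans_lt hy)
  intro ζ hζ
  have key := le_on_disc_of_le_on_sphere hΩ hv_usc (fun a b hab g hg hle => by
    have ha : a ∈ Ω := by simpa using hab 0 (by simp)
    rw [← EReal.coe_le_coe_iff, hcoe a ha]
    refine max_le (hsub a b hab g hg fun ζ hζ => ?_) ?_
    · exact (huv _ (hab ζ (sphere_subset_closedBall hζ))).trans (EReal.coe_le_coe_iff.2 (hle ζ hζ))
    · rw [EReal.coe_le_coe_iff]
      have := Real.circleAverage_mono (c := 0) (R := 1) (f₁ := fun _ => M) (f₂ := g)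
        (circleIntegrable_const M 0 1) (hg.circleIntegrable zero_le_one) (fun ζ hζ => by
          rw [abs_one] at hζ
          exact (hMv _ (hab ζ (sphere_subset_closedBall hζ))).trans (hle ζ hζ))
      rwa [Real.circleAverage_const] at this) hW h₁ h₂ hr hball hmaps (M := M) (fun ζ hζ => by
    rw [← EReal.coe_le_coe_iff, hcoe _ (hmaps ζ (sphere_subset_closedBall hζ))]
    exact max_le (hM ζ hζ) le_rfl) ζ hζ
  exact (huv _ (hmaps ζ hζ)).trans (EReal.coe_le_coe_iff.2 key)

/-- Strict version of the maximum principle along holomorphic discs. -/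
lemma PlurisubharmonicOn.lt_on_disc {u : ℂ × ℂ → EReal} {Ω : Set (ℂ × ℂ)} (hΩ : IsOpen Ω)
    (hu : PlurisubharmonicOn u Ω)
    {f₁ f₂ : ℂ → ℂ} {W : Set ℂ} (hW : IsOpen W) (h₁ : DifferentiableOn ℂ f₁ W)
    (h₂ : DifferentiableOn ℂ f₂ W) {c : ℂ} {r : ℝ} (hr : 0 < r) (hball : closedBall c r ⊆ W)
    (hmaps : ∀ ζ ∈ closedBall c r, (f₁ ζ, f₂ ζ) ∈ Ω) {M : ℝ}
    (hM : ∀ ζ ∈ sphere c r, u (f₁ ζ, f₂ ζ) < M) :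
    ∀ ζ ∈ closedBall c r, u (f₁ ζ, f₂ ζ) < M := by
  have hfc : ContinuousOn (fun ζ => (f₁ ζ, f₂ ζ)) (sphere c r) :=
    (h₁.continuousOn.mono (sphere_subset_closedBall.trans hball)).prodMk
      (h₂.continuousOn.mono (sphere_subset_closedBall.trans hball))
  have husc : UpperSemicontinuousOn (fun ζ => u (f₁ ζ, f₂ ζ)) (sphere c r) :=
    hu.1.comp hfc (fun ζ hζ => hmaps ζ (sphere_subset_closedBall hζ))
  obtain ⟨ζm, hζm, hmax⟩ := husc.exists_isMaxOn (NormedSpace.sphere_nonempty.2 hr.le)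
    (isCompact_sphere c r)
  obtain ⟨M', h1, h2⟩ := EReal.lt_iff_exists_real_btwn.1 (hM ζm hζm)
  intro ζ hζ
  exact (hu.le_on_disc hΩ hW h₁ h₂ hr hball hmaps
    (fun ζ hζ => (hmax hζ).trans h1.le) ζ hζ).trans_lt h2

/-! ### Logarithmic potential of a smooth arc -/

lemma IsArc.isCompact {A : Set ℂ} (hA : IsArc A) : IsCompact A := by
  obtain ⟨γ, hγ, -, rfl⟩ := hA
  exact isCompact_Icc.image_of_continuousOn hγ.continuousOn

lemma IsArc.nonempty {A : Set ℂ} (hA : IsArc A) : A.Nonempty := by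
  obtain ⟨γ, -, -, rfl⟩ := hA
  exact (nonempty_Icc.2 zero_le_one).image γ

/-- A smooth arc contains a subarc that is the bi-Lipschitz image of an interval. -/
lemma IsArc.exists_antilipschitz_subarc {A : Set ℂ} (hA : IsArc A) :
    ∃ (γ : ℝ → ℂ) (a b k : ℝ), a < b ∧ 0 < k ∧ ContinuousOn γ (Icc a b) ∧
      (∀ t ∈ Icc a b, γ t ∈ A) ∧ ∀ s ∈ Icc a b, ∀ t ∈ Icc a b, k * |s - t| ≤ ‖γ s - γ t‖ := by
  obtain ⟨γ, hγ, hinj, rfl⟩ := hA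
  have hat : ∀ t ∈ Ioo (0 : ℝ) 1, HasStrictDerivAt γ (deriv γ t) t := fun t ht =>
    (hγ.contDiffAt (Icc_mem_nhds ht.1 ht.2)).hasStrictDerivAt (by simp)
  -- The parametrisation may have critical points, but injectivity prevents its derivative from
  -- vanishing identically. Strict differentiability at a regular t₀ then gives the constant k =
  -- ‖γ'(t₀)‖/2.
  obtain ⟨t₀, ht₀, hne⟩ : ∃ t ∈ Ioo (0 : ℝ) 1, deriv γ t ≠ 0 := by
    by_contra! h
    have hc := constant_of_has_deriv_right_zero (f := γ) (a := 1 / 3) (b := 2 / 3)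
      (hγ.continuousOn.mono (Icc_subset_Icc (by norm_num) (by norm_num))) (fun x hx => by
        have hx' : x ∈ Ioo (0 : ℝ) 1 := ⟨by linarith [hx.1], by linarith [hx.2]⟩
        have := (hat x hx').hasDerivAt
        rw [h x hx'] at this
        exact this.hasDerivWithinAt) (2 / 3) (by norm_num)
    have := hinj (x₁ := (2 / 3 : ℝ)) (x₂ := 1 / 3) (by norm_num) (by norm_num) hc
    norm_num at this
  have hpos : 0 < ‖deriv γ t₀‖ := norm_pos_iff.2 hne
  have ho := (hat t₀ ht₀).hasStrictFDerivAt.isLittleO.bound (half_pos hpos)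
  have hn : ∀ᶠ q : ℝ × ℝ in 𝓝 (t₀, t₀), q.1 ∈ Ioo (0 : ℝ) 1 :=
    continuous_fst.continuousAt.eventually (Ioo_mem_nhds ht₀.1 ht₀.2)
  obtain ⟨ε, hε, hb⟩ := Metric.eventually_nhds_iff.1 (ho.and hn)
  have hin : ∀ s ∈ Icc (t₀ - min (ε / 2) (1 / 2)) (t₀ + min (ε / 2) (1 / 2)), dist s t₀ < ε := by
    intro s hs
    have := min_le_left (ε / 2) (1 / 2)
    rw [Real.dist_eq, abs_lt]
    constructor <;> linarith [hs.1, hs.2]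
  have h01 : ∀ s ∈ Icc (t₀ - min (ε / 2) (1 / 2)) (t₀ + min (ε / 2) (1 / 2)),
      s ∈ Ioo (0 : ℝ) 1 := by
    intro s hs
    exact (hb (y := (s, s)) (by rw [Prod.dist_eq]; exact max_lt (hin s hs) (hin s hs))).2
  have hm : 0 < min (ε / 2) (1 / 2) := lt_min (by positivity) (by norm_num)
  refine ⟨γ, t₀ - min (ε / 2) (1 / 2), t₀ + min (ε / 2) (1 / 2), ‖deriv γ t₀‖ / 2, by linarith,
    by positivity,
    hγ.continuousOn.mono fun s hs => Ioo_subset_Icc_self (h01 s hs),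
    fun t ht => ⟨t, Ioo_subset_Icc_self (h01 t ht), rfl⟩, fun s hs t ht => ?_⟩
  have h1 := (hb (y := (s, t)) (by rw [Prod.dist_eq]; exact max_lt (hin s hs) (hin t ht))).1
  simp only [ContinuousLinearMap.toSpanSingleton_apply, Real.norm_eq_abs] at h1
  have h2 : ‖(s - t) • deriv γ t₀‖ = |s - t| * ‖deriv γ t₀‖ := by rw [norm_smul, Real.norm_eq_abs]
  have h3 := norm_sub_norm_le ((s - t) • deriv γ t₀) (γ s - γ t)
  rw [norm_sub_rev ((s - t) • deriv γ t₀), h2] at h3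
  linarith

/-- The antiderivative x log x - x is at least -1 for x ≥ 0, and it is used once on each side of c.
The bound is uniform in c, which makes the potential of the arc bounded below. -/
lemma neg_two_le_integral_log_sub {a b c : ℝ} (hac : a ≤ c) (hcb : c ≤ b) :
    -2 ≤ ∫ t in a..b, Real.log (t - c) := by
  rw [intervalIntegral.integral_comp_sub_right (fun x => Real.log x) c, integral_log]
  have key : ∀ x : ℝ, 0 ≤ x → -1 ≤ x * Real.log x - x := by
    intro x hx
    rcases hx.eq_or_lt with rfl | hx
    · norm_num
    · have := Real.one_sub_inv_le_log_of_pos hx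
      have h2 := mul_le_mul_of_nonneg_left this hx.le
      rw [mul_sub, mul_inv_cancel₀ hx.ne'] at h2
      linarith
  have h1 := key (b - c) (by linarith)
  have h2 := key (c - a) (by linarith)
  have h3 : Real.log (a - c) = Real.log (c - a) := by rw [← Real.log_neg_eq_log, neg_sub]
  rw [h3]
  linarith

/-- The complement of a smooth arc `A` carries a function that is bounded below, grows
like `log |v|²` and is locally the real part of a holomorphic function: a logarithmic potential of a
measure on the arc. -/
lemma IsArc.exists_logPotential {A : Set ℂ} (hA : IsArc A) :
    ∃ (p : ℂ → ℝ) (m R₀ : ℝ), 0 < R₀ ∧ (∀ v ∉ A, m ≤ p v) ∧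
      (∀ v ∉ A, p v ≤ 2 * Real.log (‖v‖ + R₀)) ∧
      (∀ v ∉ A, 2 * R₀ ≤ ‖v‖ → 2 * Real.log (‖v‖ / 2) ≤ p v) ∧
      ∀ v₀ ∉ A, ∃ r > 0, ∃ P : ℂ → ℂ, DifferentiableOn ℂ P (ball v₀ r) ∧
        ∀ v ∈ ball v₀ r, v ∉ A ∧ (P v).re = p v := by
  have hclosed := hA.isCompact.isClosed
  obtain ⟨R₀, hR₀, hAR⟩ := hA.isCompact.isBounded.exists_pos_norm_le
  obtain ⟨γ, a, b, k, hab, hk, hγ, hγA, hanti⟩ := hA.exists_antilipschitz_subarc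
  have hne : ∀ v ∉ A, ∀ t ∈ Icc a b, v - γ t ≠ 0 := by
    intro v hv t ht h
    exact hv (by rw [sub_eq_zero.1 h]; exact hγA t ht)
  have hcl : ∀ v ∉ A, ContinuousOn (fun t => Real.log ‖v - γ t‖) (Icc a b) := fun v hv =>
    ((continuousOn_const.sub hγ).norm).log fun t ht => norm_ne_zero_iff.2 (hne v hv t ht)
  have hil : ∀ v ∉ A, IntervalIntegrable (fun t => Real.log ‖v - γ t‖) volume a b := fun v hv =>
    (hcl v hv).intervalIntegrable_of_Icc hab.le
  have hℓ : 0 < b - a := by linarith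
  -- The measure has total mass 2, to match the growth of log|v|².
  set p : ℂ → ℝ := fun v => 2 / (b - a) * ∫ t in a..b, Real.log ‖v - γ t‖ with hp
  have hconst : ∀ x : ℝ, 2 / (b - a) * ∫ _ in a..b, x = 2 * x := by
    intro x
    rw [intervalIntegral.integral_const, smul_eq_mul]
    field_simp
  have h2ℓ : 0 ≤ 2 / (b - a) := by positivity
  refine ⟨p, 2 / (b - a) * ((b - a) * Real.log (k / 2) - 2), R₀, hR₀, ?_, ?_, ?_, ?_⟩
  · intro v hv
    refine mul_le_mul_of_nonneg_left ?_ h2ℓ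
    -- For the parameter t' nearest to v, ‖γ t - γ t'‖ ≤ 2‖v - γ t‖, so the integrand is at least
    -- log(k|t - t'|/2), whose integral is bounded below independently of v and t'.
    obtain ⟨t', ht', hmin⟩ := isCompact_Icc.exists_isMinOn (nonempty_Icc.2 hab.le)
      ((continuousOn_const.sub hγ).norm : ContinuousOn (fun t => ‖v - γ t‖) (Icc a b))
    have hi : IntervalIntegrable (fun t => Real.log (t - t')) volume a b := by
      have := (intervalIntegral.intervalIntegrable_log' (a := a - t') (b := b - t')).comp_sub_right t'
      simpa using this
    have hle : ∫ t in a..b, (Real.log (k / 2) + Real.log (t - t')) ≤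
        ∫ t in a..b, Real.log ‖v - γ t‖ := by
      refine intervalIntegral.integral_mono_ae_restrict hab.le
        (intervalIntegrable_const.add hi) (hil v hv) ?_
      have hae : ∀ᵐ t : ℝ ∂(volume.restrict (Icc a b)), t ≠ t' :=
        ae_restrict_of_ae (by simp [ae_iff])
      filter_upwards [hae, ae_restrict_mem measurableSet_Icc] with t htne ht
      have h1 := hanti t ht t' ht'
      have h2 : ‖v - γ t'‖ ≤ ‖v - γ t‖ := hmin ht
      have h3 : ‖γ t - γ t'‖ ≤ ‖v - γ t'‖ + ‖v - γ t‖ := by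
        have := norm_sub_le (v - γ t') (v - γ t)
        rwa [sub_sub_sub_cancel_left] at this
      have h4 : 0 < |t - t'| := abs_pos.2 (sub_ne_zero.2 htne)
      rw [← Real.log_abs (t - t'), ← Real.log_mul (by positivity) h4.ne']
      exact Real.log_le_log (by positivity) (by linarith)
    rw [intervalIntegral.integral_add intervalIntegrable_const hi, intervalIntegral.integral_const,
      smul_eq_mul] at hle
    linarith [neg_two_le_integral_log_sub ht'.1 ht'.2]
  · intro v hv
    rw [← hconst]
    refine mul_le_mul_of_nonneg_left ?_ h2ℓ
    refine intervalIntegral.integral_mono_on hab.le (hil v hv) intervalIntegrable_const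
      fun t ht => ?_
    refine Real.log_le_log (norm_pos_iff.2 (hne v hv t ht)) ((norm_sub_le _ _).trans ?_)
    linarith [hAR _ (hγA t ht)]
  · intro v hv hvR
    rw [← hconst]
    refine mul_le_mul_of_nonneg_left ?_ h2ℓ
    refine intervalIntegral.integral_mono_on hab.le intervalIntegrable_const (hil v hv)
      fun t ht => ?_
    refine Real.log_le_log (by linarith) (le_trans ?_ (norm_sub_norm_le v (γ t)))
    linarith [hAR _ (hγA t ht)]
  · intro v₀ hv₀
    obtain ⟨r, hr, hball⟩ := Metric.isOpen_iff.1 hclosed.isOpen_compl v₀ hv₀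
    have hfar : ∀ t ∈ Icc a b, r ≤ ‖v₀ - γ t‖ := by
      intro t ht
      by_contra! h
      refine hball (a := γ t) ?_ (hγA t ht)
      rwa [mem_ball, dist_comm, dist_eq_norm]
    have hsub : ball v₀ (r / 2) ⊆ ball v₀ r := ball_subset_ball (by linarith)
    have hfar' : ∀ v ∈ ball v₀ (r / 2), ∀ t ∈ Icc a b, r / 2 ≤ ‖v - γ t‖ := by
      intro v hv t ht
      have h1 := hfar t ht
      have h2 : ‖v₀ - v‖ < r / 2 := by rwa [mem_ball, dist_comm, dist_eq_norm] at hv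
      have h3 := norm_add_le (v₀ - v) (v - γ t)
      rw [sub_add_sub_cancel] at h3
      linarith
    -- Normalising by v₀ - γ t keeps the quotient within distance 1 of 1, where the principal
    -- logarithm is holomorphic; the real constant log‖v₀ - γ t‖ restores the real part.
    have hslit : ∀ v ∈ ball v₀ (r / 2), ∀ t ∈ Icc a b,
        (v - γ t) / (v₀ - γ t) ∈ Complex.slitPlane := by
      intro v hv t ht
      have h0 := hne v₀ hv₀ t ht
      have h1 : (v - γ t) / (v₀ - γ t) = 1 + (v - v₀) / (v₀ - γ t) := by field_simp; ring
      rw [h1]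
      apply Complex.mem_slitPlane_of_norm_lt_one
      rw [norm_div, div_lt_one (norm_pos_iff.2 h0)]
      have h2 : ‖v - v₀‖ < r / 2 := by rwa [mem_ball, dist_eq_norm] at hv
      linarith [hfar t ht]
    have huI : ∀ t, t ∈ uIoc a b → t ∈ Icc a b := fun t ht => by
      rw [uIoc_of_le hab.le] at ht
      exact Ioc_subset_Icc_self ht
    set F : ℂ → ℝ → ℂ := fun v t =>
      Complex.log ((v - γ t) / (v₀ - γ t)) + (Real.log ‖v₀ - γ t‖ : ℂ) with hF
    have hγc : ∀ v : ℂ, ContinuousOn (fun t => v - γ t) (Icc a b) :=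
      fun v => continuousOn_const.sub hγ
    have hFc : ∀ v ∈ ball v₀ (r / 2), ContinuousOn (F v) (Icc a b) := fun v hv =>
      (((hγc v).div (hγc v₀) fun t ht => hne v₀ hv₀ t ht).clog (hslit v hv)).add
        (Complex.continuous_ofReal.comp_continuousOn (hcl v₀ hv₀))
    refine ⟨r / 2, by positivity, fun v => (2 / (b - a) : ℝ) * ∫ t in a..b, F v t, ?_, ?_⟩
    · intro v hv
      have hF'c : ContinuousOn (fun t => 1 / (v - γ t)) (Icc a b) :=
        continuousOn_const.div (hγc v) fun t ht => hne v (hball (hsub hv)) t ht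
      have hmem := isOpen_ball.mem_nhds hv
      have := intervalIntegral.hasDerivAt_integral_of_dominated_loc_of_deriv_le (μ := volume)
        (F := F) (F' := fun v t => 1 / (v - γ t)) (bound := fun _ => 1 / (r / 2)) (a := a) (b := b)
        hmem (by
          filter_upwards [hmem] with x hx
          rw [uIoc_of_le hab.le]
          exact ((hFc x hx).mono Ioc_subset_Icc_self).aestronglyMeasurable measurableSet_Ioc)
        ((hFc v hv).intervalIntegrable_of_Icc hab.le) (by
          rw [uIoc_of_le hab.le]
          exact (hF'c.mono Ioc_subset_Icc_self).aestronglyMeasurable measurableSet_Ioc)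
        (Eventually.of_forall fun t ht x hx => by
          rw [norm_div, norm_one]
          exact one_div_le_one_div_of_le (by positivity) (hfar' x hx t (huI t ht)))
        intervalIntegrable_const
        (Eventually.of_forall fun t ht x hx => by
          have h0 := hne v₀ hv₀ t (huI t ht)
          have h1 := hne x (hball (hsub hx)) t (huI t ht)
          have := ((((hasDerivAt_id x).sub_const (γ t)).div_const (v₀ - γ t)).clog
            (hslit x hx t (huI t ht))).add_const (Real.log ‖v₀ - γ t‖ : ℂ)
          have e : 1 / (x - γ t) = 1 / (v₀ - γ t) / ((x - γ t) / (v₀ - γ t)) := by field_simp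
          simp only [hF, e]
          exact this)
      exact (this.2.differentiableAt.const_mul _).differentiableWithinAt
    · intro v hv
      refine ⟨hball (hsub hv), ?_⟩
      rw [Complex.re_ofReal_mul, hp]
      congr 1
      have h1 := Complex.reCLM.intervalIntegral_comp_comm ((hFc v hv).intervalIntegrable_of_Icc hab.le
        : IntervalIntegrable (F v) volume a b)
      rw [Complex.reCLM_apply] at h1
      rw [← h1]
      refine intervalIntegral.integral_congr fun t ht => ?_
      rw [uIcc_of_le hab.le] at ht
      have h0 := norm_ne_zero_iff.2 (hne v₀ hv₀ t ht)
      have h2 := norm_ne_zero_iff.2 (hne v (hball (hsub hv)) t ht)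
      simp only [hF, Complex.reCLM_apply, Complex.add_re, Complex.log_re, Complex.ofReal_re,
        norm_div]
      rw [Real.log_div h2 h0]
      ring

/-! ### From the twisted arc to an open set -/

lemma EReal.nonpos_of_forall_lt_coe {x : EReal} (h : ∀ M : ℝ, 0 < M → x < M) : x ≤ 0 := by
  by_contra! hx
  obtain ⟨M, h0, hM⟩ := EReal.lt_iff_exists_real_btwn.1 hx
  exact (h M (by exact_mod_cast h0)).not_gt hM

/-- A plurisubharmonic function that is upper semicontinuous up to the boundary is nonpositive on a
complex disc through the origin as soon as it is so on the boundary circle. -/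
lemma PlurisubharmonicOn.nonpos_on_radial_disc {U : ℂ × ℂ → EReal}
    (husc : UpperSemicontinuousOn U (univ ×ˢ closedBall 0 1))
    (hpsh : PlurisubharmonicOn U (univ ×ˢ ball 0 1)) {a : ℂ}
    (ha : ∀ τ : ℂ, ‖τ‖ = 1 → U (τ * a, τ) ≤ 0) {σ : ℂ} (hσ : ‖σ‖ ≤ 1) : U (σ * a, σ) ≤ 0 := by
  rcases hσ.eq_or_lt with h1 | hlt
  · exact ha σ h1
  refine EReal.nonpos_of_forall_lt_coe fun M hM => ?_
  have hu : UpperSemicontinuousOn (fun ζ : ℂ => U (ζ * a, ζ)) (closedBall 0 1) :=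
    husc.comp (g := fun ζ : ℂ => (ζ * a, ζ)) (by fun_prop) (fun ζ hζ => ⟨mem_univ _, hζ⟩)
  -- Plurisubharmonicity holds only over the open disc. The set where U ≥ M > 0 is compact and
  -- misses the unit circle, so a circle of radius r < 1 can serve as boundary.
  have hc := hu.isCompact_inter_preimage_Ici (isCompact_closedBall 0 1) (M : EReal)
  obtain ⟨r₀, hr₀, hbad⟩ : ∃ r₀ : ℝ, r₀ < 1 ∧ ∀ ζ : ℂ, ‖ζ‖ ≤ 1 → M ≤ U (ζ * a, ζ) → ‖ζ‖ ≤ r₀ := by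
    rcases (closedBall (0 : ℂ) 1 ∩ (fun ζ : ℂ => U (ζ * a, ζ)) ⁻¹' Ici (M : EReal)).eq_empty_or_nonempty
      with he | hne
    · refine ⟨0, one_pos, fun ζ hζ hMζ => ?_⟩
      have : ζ ∈ closedBall (0 : ℂ) 1 ∩ (fun ζ : ℂ => U (ζ * a, ζ)) ⁻¹' Ici (M : EReal) :=
        ⟨by simpa using hζ, hMζ⟩
      rw [he] at this
      exact this.elim
    · obtain ⟨ζm, ⟨hζm, hζM⟩, hmax⟩ := hc.exists_isMaxOn hne continuous_norm.continuousOn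
      refine ⟨‖ζm‖, ?_, fun ζ hζ hMζ => hmax ⟨by simpa using hζ, hMζ⟩⟩
      refine lt_of_le_of_ne (by simpa using hζm) fun h => ?_
      have h0 : (M : EReal) ≤ 0 := le_trans hζM (ha ζm h)
      exact absurd (by exact_mod_cast h0 : M ≤ 0) (not_le.2 hM)
  obtain ⟨r, hr, hr1⟩ := exists_between (max_lt hr₀ (max_lt hlt one_pos))
  have hr2 := max_lt_iff.1 hr
  have hr3 := max_lt_iff.1 hr2.2
  refine hpsh.lt_on_disc (isOpen_univ.prod isOpen_ball) isOpen_univ (f₁ := fun ζ => ζ * a)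
    (f₂ := fun ζ => ζ) (by fun_prop) (by fun_prop) (c := 0) (r := r) hr3.2 (subset_univ _)
    (fun ζ hζ => ⟨mem_univ _, ?_⟩) (fun ζ hζ => ?_) σ (by simpa using hr3.1.le)
  · exact closedBall_subset_ball hr1 hζ
  · have hn : ‖ζ‖ = r := by simpa using hζ
    by_contra! hcon
    linarith [hbad ζ (by linarith) hcon]

/-- If a plurisubharmonic function on `ℂ × 𝔻` is nonpositive on the twisted arc `τ A` for `|τ| = 1`,
then it is nonpositive on an open set near `(0, 0)` that depends only on `A`. -/
lemma IsArc.exists_nonpos_region {A : Set ℂ} (hA : IsArc A) :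
    ∃ ρ R₀ : ℝ, 0 < ρ ∧ 0 < R₀ ∧ ∀ U : ℂ × ℂ → EReal,
      UpperSemicontinuousOn U (univ ×ˢ closedBall 0 1) →
      PlurisubharmonicOn U (univ ×ˢ ball 0 1) →
      (∀ a ∈ A, ∀ τ : ℂ, ‖τ‖ = 1 → U (τ * a, τ) ≤ 0) →
      ∀ w τ : ℂ, τ ≠ 0 → ‖τ‖ < 1 → ‖w‖ + R₀ * ‖τ‖ < ρ → U (w, τ) ≤ 0 := by
  obtain ⟨p, m, R₀, hR₀, hpm, hup, hlow, hloc⟩ := hA.exists_logPotential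
  refine ⟨Real.exp (m / 2), R₀, Real.exp_pos _, hR₀, fun U husc hpsh hbd => ?_⟩
  have hdisc : ∀ a ∈ A, ∀ σ : ℂ, ‖σ‖ ≤ 1 → U (σ * a, σ) ≤ 0 := fun a ha σ hσ =>
    hpsh.nonpos_on_radial_disc husc (hbd a ha) hσ
  have hpc : ∀ v₀ ∉ A, ContinuousAt p v₀ := by
    intro v₀ hv₀
    obtain ⟨r, hr, P, hP, hPp⟩ := hloc v₀ hv₀
    have hnb := ball_mem_nhds v₀ hr
    have h1 : ContinuousAt (fun v => (P v).re) v₀ :=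
      Complex.continuous_re.continuousAt.comp (hP.differentiableAt hnb).continuousAt
    refine h1.congr ?_
    filter_upwards [hnb] with v hv using (hPp v hv).2
  -- This is the comparison s ≤ (1+δ)(p - m). The factor 1+δ makes the right side win at infinity,
  -- where both sides grow like log|v|².
  have claim : ∀ ε δ : ℝ, 0 < ε → 0 < δ → ∀ v τ : ℂ, ‖τ‖ ≤ 1 → ε ≤ U (τ * v, τ) →
      -2 * Real.log ‖τ‖ ≤ (1 + δ) * (p v - m) := by
    intro ε δ hε hδ v₁ τ₁ hτ₁ hU₁
    by_contra! hcon
    set B : Set (ℂ × ℂ) := {q | ‖q.2‖ ≤ 1 ∧ ε ≤ U (q.2 * q.1, q.2)} with hB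
    have hBA : ∀ q ∈ B, q.1 ∉ A := by
      intro q hq hqA
      have h0 : (ε : EReal) ≤ 0 := hq.2.trans (hdisc _ hqA _ hq.1)
      exact absurd (by exact_mod_cast h0 : ε ≤ 0) (not_le.2 hε)
    have h00 : U (0, 0) < ε := by
      obtain ⟨a, ha⟩ := hA.nonempty
      have := hdisc a ha 0 (by simp)
      rw [zero_mul] at this
      exact this.trans_lt (by exact_mod_cast hε)
    have hB0 : ∀ q ∈ B, q.2 ≠ 0 := by
      intro q hq h
      have := hq.2
      rw [h, zero_mul] at this
      exact absurd h00 (not_lt.2 this)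
    obtain ⟨ρ', hρ', hnear⟩ : ∃ ρ' > 0, ∀ w τ : ℂ, ‖w‖ < ρ' → ‖τ‖ < ρ' → U (w, τ) < ε := by
      have hmem : ((0 : ℂ), (0 : ℂ)) ∈ (univ ×ˢ ball 0 1 : Set (ℂ × ℂ)) := ⟨mem_univ _, by simp⟩
      have h := hpsh.1 _ hmem ε h00
      rw [(isOpen_univ.prod isOpen_ball).nhdsWithin_eq hmem] at h
      obtain ⟨ρ', hρ', hb⟩ := Metric.eventually_nhds_iff.1 h
      refine ⟨ρ', hρ', fun w τ hw hτ => hb ?_⟩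
      rw [Prod.dist_eq]
      simpa using ⟨hw, hτ⟩
    have hBnorm : ∀ q ∈ B, -2 * Real.log ‖q.2‖ ≤
        2 * Real.log (max 1 ‖q.1‖) - 2 * Real.log ρ' := by
      intro q hq
      have hq0 := norm_pos_iff.2 (hB0 q hq)
      have hmx : 0 < max 1 ‖q.1‖ := lt_max_of_lt_left one_pos
      have hle : ρ' ≤ ‖q.2‖ * max 1 ‖q.1‖ := by
        by_contra! hlt
        refine absurd (hnear (q.2 * q.1) q.2 ?_ ?_) (not_lt.2 hq.2)
        · rw [norm_mul]
          exact (mul_le_mul_of_nonneg_left (le_max_right _ _) hq0.le).trans_lt hlt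
        · exact (le_mul_of_one_le_right hq0.le (le_max_left _ _)).trans_lt hlt
      have := Real.log_le_log hρ' hle
      rw [Real.log_mul hq0.ne' hmx.ne'] at this
      linarith
    obtain ⟨R, hR1, hR⟩ : ∃ R : ℝ, 0 < R ∧ ∀ q ∈ B, R ≤ ‖q.1‖ →
        -2 * Real.log ‖q.2‖ - (1 + δ) * (p q.1 - m) ≤ 0 := by
      -- For large ‖v‖ the two growth bounds give a difference of at most C - 2δ log‖v‖, whence the
      -- radius exp(C/(2δ)).
      set C := -2 * Real.log ρ' + (1 + δ) * (2 * Real.log 2 + m) with hC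
      refine ⟨max (max 1 (2 * R₀)) (Real.exp (C / (2 * δ))), by positivity, fun q hq hqR => ?_⟩
      have h1 : 1 ≤ ‖q.1‖ := le_trans ((le_max_left _ _).trans (le_max_left _ _)) hqR
      have h2 : 2 * R₀ ≤ ‖q.1‖ := le_trans ((le_max_right _ _).trans (le_max_left _ _)) hqR
      have h3 := (Real.le_log_iff_exp_le (by linarith)).2 ((le_max_right _ _).trans hqR)
      rw [div_le_iff₀ (by positivity)] at h3
      have h4 := hBnorm q hq
      rw [max_eq_right h1] at h4
      have h5 := hlow q.1 (hBA q hq) h2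
      rw [Real.log_div (by linarith) two_ne_zero] at h5
      have h6 := mul_le_mul_of_nonneg_left h5 (by linarith : (0 : ℝ) ≤ 1 + δ)
      nlinarith
    set D := -2 * Real.log ‖τ₁‖ - (1 + δ) * (p v₁ - m) with hD
    have hDpos : 0 < D := by linarith
    -- The perturbation η‖v‖² makes the comparison strict. It costs at most D/2, so at a maximiser
    -- the unperturbed difference stays positive, forcing ‖v₀‖ < R and ‖τ₀‖ < 1.
    set η := D / (2 * R ^ 2) with hη
    have hηpos : 0 < η := by positivity
    have hηR : η * R ^ 2 = D / 2 := by rw [hη]; field_simp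
    set Q : ℂ × ℂ → ℝ := fun q =>
      -2 * Real.log ‖q.2‖ - (1 + δ) * (p q.1 - m) + η * ‖q.1‖ ^ 2 with hQ
    have hBclosed : IsClosed B := by
      have hu : UpperSemicontinuousOn (fun q : ℂ × ℂ => U (q.2 * q.1, q.2))
          (univ ×ˢ closedBall 0 1) :=
        husc.comp (g := fun q : ℂ × ℂ => (q.2 * q.1, q.2)) (by fun_prop) (fun q hq => hq)
      rw [← isOpen_compl_iff, isOpen_iff_mem_nhds]
      intro q hq
      by_cases hq1 : ‖q.2‖ ≤ 1
      · have hlt : U (q.2 * q.1, q.2) < ε := by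
          by_contra! h
          exact hq ⟨hq1, h⟩
        have h := hu q ⟨mem_univ _, by simpa using hq1⟩ ε hlt
        rw [eventually_nhdsWithin_iff] at h
        filter_upwards [h] with x hx hxB
        exact absurd hxB.2 (not_le.2 (hx ⟨mem_univ _, by simpa using hxB.1⟩))
      · have : {x : ℂ × ℂ | 1 < ‖x.2‖} ∈ 𝓝 q :=
          (isOpen_lt continuous_const (by fun_prop)).mem_nhds (not_le.1 hq1)
        filter_upwards [this] with x hx hxB
        exact absurd hxB.1 (not_le.2 hx)
    set X := B ∩ closedBall 0 R ×ˢ closedBall 0 1 with hX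
    have hXc : IsCompact X :=
      ((isCompact_closedBall (0 : ℂ) R).prod (isCompact_closedBall (0 : ℂ) 1)).inter_left hBclosed
    have hmemX : ∀ q ∈ B, ‖q.1‖ ≤ R → q ∈ X := fun q hq hqR =>
      ⟨hq, by simpa using hqR, by simpa using hq.1⟩
    have hQc : ContinuousOn Q X := by
      intro q hq
      refine ContinuousAt.continuousWithinAt ?_
      have c1 : ContinuousAt (fun q : ℂ × ℂ => p q.1) q :=
        (hpc q.1 (hBA q hq.1)).comp (f := Prod.fst) continuousAt_fst
      have c2 : ContinuousAt (fun q : ℂ × ℂ => Real.log ‖q.2‖) q :=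
        continuousAt_snd.norm.log (norm_ne_zero_iff.2 (hB0 q hq.1))
      have c3 : ContinuousAt (fun q : ℂ × ℂ => ‖q.1‖ ^ 2) q := by fun_prop
      exact ((c2.const_mul _).sub ((c1.sub_const m).const_mul _)).add (c3.const_mul _)
    have hB₁ : ((v₁, τ₁) : ℂ × ℂ) ∈ B := ⟨hτ₁, hU₁⟩
    have hv₁R : ‖v₁‖ ≤ R := by
      by_contra! h
      have := hR _ hB₁ h.le
      simp only at this
      linarith
    obtain ⟨⟨v₀, τ₀⟩, hq₀, hmax⟩ := hXc.exists_isMaxOn ⟨_, hmemX _ hB₁ hv₁R⟩ hQc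
    have hQ₀ : D ≤ Q (v₀, τ₀) := by
      refine le_trans ?_ (hmax (hmemX _ hB₁ hv₁R))
      simp only [hQ]
      nlinarith [sq_nonneg ‖v₁‖]
    have hB₀ := hq₀.1
    have hv₀A := hBA _ hB₀
    have hτ₀0 := hB0 _ hB₀
    have hv₀R' : ‖v₀‖ ≤ R := by simpa using hq₀.2.1
    have hηv₀ : η * ‖v₀‖ ^ 2 ≤ D / 2 := by rw [← hηR]; gcongr
    have hv₀R : ‖v₀‖ < R := by
      by_contra! h
      have := hR _ hB₀ h
      simp only [hQ] at hQ₀ this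
      linarith
    have hτ₀1 : ‖τ₀‖ < 1 := by
      have h1 := hpm _ hv₀A
      have h2 : 0 ≤ (1 + δ) * (p v₀ - m) := mul_nonneg (by linarith) (by simpa using h1)
      simp only [hQ] at hQ₀
      have h3 : Real.log ‖τ₀‖ < 0 := by linarith
      by_contra! h
      linarith [Real.log_nonneg h]
    obtain ⟨r, hr, P, hP, hPp⟩ := hloc v₀ hv₀A
    -- The graph τ = T(v) passes through (v₀, τ₀), and `L` cancels the harmonic part of the
    -- variation of `Q`. On the circle of radius s, `Q` exceeds its maximum by ηs², so the graph
    -- leaves `B` there; the strict maximum principle then expels the centre too.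
    set L : ℂ → ℂ := fun v => (1 + δ : ℝ) * (P v - P v₀) -
      (2 * η : ℝ) * ((starRingEnd ℂ) v₀ * (v - v₀)) with hL
    have hLd : DifferentiableOn ℂ L (ball v₀ r) :=
      ((hP.sub_const _).const_mul _).sub
        (((differentiableOn_id.sub_const _).const_mul _).const_mul _)
    set T : ℂ → ℂ := fun v => τ₀ * Complex.exp (-L v / 2) with hT
    have hTd : DifferentiableOn ℂ T (ball v₀ r) := ((hLd.neg.div_const 2).cexp).const_mul _
    have hTv₀ : T v₀ = τ₀ := by simp [hT, hL]
    have hTlog : ∀ v, -2 * Real.log ‖T v‖ = -2 * Real.log ‖τ₀‖ + (L v).re := by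
      intro v
      have : (-L v / 2).re = -(L v).re / 2 := by
        rw [← Complex.ofReal_ofNat, Complex.div_ofReal_re, Complex.neg_re]
      rw [hT, norm_mul, Real.log_mul (norm_ne_zero_iff.2 hτ₀0) (by simp), Complex.norm_exp,
        Real.log_exp, this]
      ring
    have hTc : ContinuousAt T v₀ := (hTd.differentiableAt (ball_mem_nhds v₀ hr)).continuousAt
    have hev : ∀ᶠ v in 𝓝 v₀, ‖T v‖ < 1 ∧ ‖v‖ < R ∧ v ∈ ball v₀ r := by
      refine (hTc.norm.eventually (gt_mem_nhds (by simp only [hTv₀]; exact hτ₀1))).and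
        ((continuous_norm.continuousAt.eventually (gt_mem_nhds hv₀R)).and (ball_mem_nhds v₀ hr))
    obtain ⟨s, hs, hsball⟩ := Metric.nhds_basis_closedBall.eventually_iff.1 hev
    have hsphere : ∀ v ∈ sphere v₀ s, U (T v * v, T v) < ε := by
      intro v hv
      obtain ⟨hT1, hvR, hvr⟩ := hsball (sphere_subset_closedBall hv)
      by_contra! hUv
      have hvB : ((v, T v) : ℂ × ℂ) ∈ B := ⟨hT1.le, hUv⟩
      have hle : Q (v, T v) ≤ Q (v₀, τ₀) := hmax (hmemX _ hvB hvR.le)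
      simp only [hQ, hTlog] at hle
      have hre : (L v).re = (1 + δ) * (p v - p v₀) -
          2 * η * ((starRingEnd ℂ) v₀ * (v - v₀)).re := by
        simp only [hL, Complex.sub_re, Complex.re_ofReal_mul, (hPp v hvr).2,
          (hPp v₀ (mem_ball_self hr)).2]
      have hsq : ‖v‖ ^ 2 = ‖v₀‖ ^ 2 + 2 * ((starRingEnd ℂ) v₀ * (v - v₀)).re + s ^ 2 := by
        have hvs : ‖v - v₀‖ = s := by simpa [dist_eq_norm] using hv
        rw [← hvs, Complex.sq_norm, Complex.sq_norm, Complex.sq_norm, Complex.normSq_apply,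
          Complex.normSq_apply, Complex.normSq_apply]
        simp only [Complex.mul_re, Complex.sub_re, Complex.sub_im, Complex.conj_re,
          Complex.conj_im]
        ring
      rw [hre, hsq] at hle
      nlinarith [mul_pos hηpos (mul_pos hs hs)]
    have hfin := hpsh.lt_on_disc (isOpen_univ.prod isOpen_ball) isOpen_ball
      (f₁ := fun v => T v * v) (f₂ := T) (hTd.mul differentiableOn_id) hTd hs
      (fun v hv => (hsball hv).2.2)
      (fun v hv => ⟨mem_univ _, by simpa using (hsball hv).1⟩) hsphere v₀ (mem_closedBall_self hs.le)
    rw [hTv₀] at hfin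
    exact absurd hB₀.2 (not_le.2 hfin)
  intro w τ hτ hτ1 hw
  have hwv : τ * (w / τ) = w := mul_div_cancel₀ w hτ
  by_cases hv : w / τ ∈ A
  · have := hdisc _ hv τ hτ1.le
    rwa [hwv] at this
  have hτ0 := norm_pos_iff.2 hτ
  have hlt : p (w / τ) - m < -2 * Real.log ‖τ‖ := by
    have h1 := hup _ hv
    have h2 : ‖w / τ‖ + R₀ = (‖w‖ + R₀ * ‖τ‖) / ‖τ‖ := by rw [norm_div]; field_simp
    have hpos : 0 < ‖w‖ + R₀ * ‖τ‖ := by positivity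
    rw [h2, Real.log_div hpos.ne' hτ0.ne'] at h1
    have h3 := (Real.log_lt_iff_lt_exp hpos).2 hw
    linarith
  refine EReal.nonpos_of_forall_lt_coe fun ε hε => ?_
  by_contra! hcon
  have hpv := hpm _ hv
  -- The strict inequality `hlt` leaves room for the factor 1+δ.
  obtain ⟨δ, hδ, hδlt⟩ : ∃ δ : ℝ, 0 < δ ∧ δ * (p (w / τ) - m + 1) < -2 * Real.log ‖τ‖ -
      (p (w / τ) - m) := by
    refine ⟨(-2 * Real.log ‖τ‖ - (p (w / τ) - m)) / (2 * (p (w / τ) - m + 1)),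
      div_pos (by linarith) (by linarith), ?_⟩
    have : 0 < p (w / τ) - m + 1 := by linarith
    field_simp
    linarith
  have := claim ε δ hε hδ (w / τ) τ hτ1.le (by rwa [hwv])
  nlinarith

/-! ### The logarithmic competitor on the projective line -/

/-- The sub-mean-value inequality for `log |z|²` on the unit circle. -/
lemma log_sq_norm_le_circleAverage {a b : ℂ} {g : ℂ → ℝ} (hg : ContinuousOn g (sphere 0 1))
    (hle : ∀ ζ ∈ sphere (0 : ℂ) 1, ENNReal.log (ENNReal.ofReal (‖a + ζ * b‖ ^ 2)) ≤ g ζ) :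
    ENNReal.log (ENNReal.ofReal (‖a‖ ^ 2)) ≤ (Real.circleAverage g 0 1 : ℝ) := by
  have hgi : CircleIntegrable g 0 1 := hg.circleIntegrable zero_le_one
  rcases eq_or_ne a 0 with rfl | ha
  · simp
  have hapos : 0 < ‖a‖ := norm_pos_iff.2 ha
  have hreal : ∀ ζ ∈ sphere (0 : ℂ) 1, a + ζ * b ≠ 0 → 2 * Real.log ‖a + ζ * b‖ ≤ g ζ := by
    intro ζ hζ hne
    have h := hle ζ hζ
    rw [ENNReal.log_ofReal_of_pos (by positivity), EReal.coe_le_coe_iff, Real.log_pow] at h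
    exact_mod_cast h
  rw [ENNReal.log_ofReal_of_pos (by positivity), EReal.coe_le_coe_iff, Real.log_pow]
  push_cast
  rcases eq_or_ne b 0 with rfl | hb
  · have := Real.circleAverage_mono (c := 0) (R := 1) (f₁ := fun _ => 2 * Real.log ‖a‖) (f₂ := g)
      (circleIntegrable_const _ 0 1) hgi (fun ζ hζ => by
        rw [abs_one] at hζ
        simpa using hreal ζ hζ (by simpa using ha))
    rwa [Real.circleAverage_const] at this
  have hbpos : 0 < ‖b‖ := norm_pos_iff.2 hb
  have hfac : ∀ ζ : ℂ, a + ζ * b = b * (ζ - -(a / b)) := fun ζ => by field_simp; ring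
  set f : ℂ → ℝ := fun ζ => 2 * (Real.log ‖b‖ + Real.log ‖ζ - -(a / b)‖) with hf
  have hi : CircleIntegrable (fun ζ : ℂ => Real.log ‖ζ - -(a / b)‖) 0 1 :=
    circleIntegrable_log_norm_sub_const 1
  have hfi : CircleIntegrable f 0 1 :=
    ((circleIntegrable_const (Real.log ‖b‖) 0 1).add hi).const_smul (a := (2 : ℝ))
  have hfavg : Real.circleAverage f 0 1 = 2 * (Real.log ‖b‖ + Real.posLog ‖a / b‖) := by
    have h1 : f = (2 : ℝ) • ((fun _ => Real.log ‖b‖) + fun ζ : ℂ => Real.log ‖ζ - -(a / b)‖) := by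
      ext ζ; simp [hf]
    rw [h1, Real.circleAverage_smul, Real.circleAverage_add (circleIntegrable_const _ 0 1) hi,
      Real.circleAverage_const, circleAverage_log_norm_sub_const_eq_posLog, norm_neg, smul_eq_mul]
  -- At a zero of a + ζb the hypothesis says only -∞ ≤ g, whereas `Real.log 0 = 0`. Replacing the
  -- value at this one point does not change the mean.
  set f' : ℂ → ℝ := fun ζ => if ζ = -(a / b) then g ζ else f ζ with hf'
  have hcong : f =ᶠ[codiscreteWithin (sphere (0 : ℂ) |1|)] f' := by
    filter_upwards [compl_singleton_mem_codiscreteWithin (-(a / b))] with ζ hζ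
    exact (if_neg hζ).symm
  have hle' : Real.circleAverage f' 0 1 ≤ Real.circleAverage g 0 1 := by
    refine Real.circleAverage_mono (hfi.congr_codiscreteWithin hcong) hgi fun ζ hζ => ?_
    rw [abs_one] at hζ
    simp only [hf']
    split_ifs with h
    · exact le_rfl
    · have hne : ζ - -(a / b) ≠ 0 := sub_ne_zero.2 h
      have h2 := hreal ζ hζ (by rw [hfac]; exact mul_ne_zero hb hne)
      rwa [hfac, norm_mul, Real.log_mul hbpos.ne' (norm_ne_zero_iff.2 hne)] at h2
  rw [← Real.circleAverage_congr_codiscreteWithin hcong one_ne_zero, hfavg] at hle'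
  have hlog : Real.log ‖a / b‖ ≤ Real.posLog ‖a / b‖ := le_max_right _ _
  rw [norm_div, Real.log_div hapos.ne' hbpos.ne'] at hlog
  rw [norm_div] at hle'
  linarith

namespace P1

lemma chartW_of_ne_zero {w : ℂ} (hw : w ≠ 0) : chartW w = chartZ w⁻¹ := if_neg hw

lemma chartW_zero : chartW 0 = OnePoint.infty := if_pos rfl

lemma continuous_chartW : Continuous chartW := by
  rw [continuous_iff_continuousAt]
  intro w
  rcases eq_or_ne w 0 with rfl | hw
  · rw [continuousAt_iff_punctured_nhds, chartW_zero]
    have h : Tendsto (fun w : ℂ => ((w⁻¹ : ℂ) : OnePoint ℂ)) (𝓝[≠] 0) (𝓝 OnePoint.infty) := by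
      refine OnePoint.tendsto_coe_infty.comp ?_
      rw [coclosedCompact_eq_cocompact, ← Metric.cobounded_eq_cocompact]
      exact tendsto_inv₀_nhdsNE_zero
    refine h.congr' ?_
    filter_upwards [self_mem_nhdsWithin] with x hx
    exact (chartW_of_ne_zero hx).symm
  · have h : ContinuousAt (fun w : ℂ => ((w⁻¹ : ℂ) : OnePoint ℂ)) w :=
      OnePoint.continuous_coe.continuousAt.comp (continuousAt_inv₀ hw)
    refine h.congr ?_
    filter_upwards [isOpen_ne.mem_nhds hw] with x hx
    exact (chartW_of_ne_zero hx).symm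

lemma continuous_chartZ : Continuous chartZ := OnePoint.continuous_coe

/-- Multiplying z by τ divides w by τ; hence the contact set over τ is the rotated arc τA. -/
lemma rot_chartW {τ : ℂ} (hτ : ‖τ‖ = 1) (a : ℂ) : rot τ (chartW (τ * a)) = chartW a := by
  have hτ0 : τ ≠ 0 := norm_ne_zero_iff.1 (by rw [hτ]; exact one_ne_zero)
  rcases eq_or_ne a 0 with rfl | ha
  · rw [mul_zero, chartW_zero]; rfl
  · rw [chartW_of_ne_zero ha, chartW_of_ne_zero (mul_ne_zero hτ0 ha)]
    change ((τ * (τ * a)⁻¹ : ℂ) : OnePoint ℂ) = ((a⁻¹ : ℂ) : OnePoint ℂ)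
    rw [mul_inv, ← mul_assoc, mul_inv_cancel₀ hτ0, one_mul]

lemma continuous_fsPotential : Continuous fsPotential := by
  unfold fsPotential
  exact (by fun_prop : Continuous fun ζ : ℂ => 1 + ‖ζ‖ ^ 2).log fun ζ => by positivity

lemma fsPotential_eq_of_norm_eq {x y : ℂ} (h : ‖x‖ = ‖y‖) : fsPotential x = fsPotential y := by
  simp [fsPotential, h]

/-- The continuous function `|z|² / (1 + |z|²)` on `ℙ¹`. -/
noncomputable def heightRatio (x : P1) : ℝ := OnePoint.elim x 1 fun z => ‖z‖ ^ 2 / (1 + ‖z‖ ^ 2)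

lemma heightRatio_chartZ (z : ℂ) : heightRatio (chartZ z) = ‖z‖ ^ 2 / (1 + ‖z‖ ^ 2) := rfl

lemma heightRatio_chartW (w : ℂ) : heightRatio (chartW w) = (1 + ‖w‖ ^ 2)⁻¹ := by
  rcases eq_or_ne w 0 with rfl | hw
  · rw [chartW_zero]
    simp [heightRatio]
  · rw [chartW_of_ne_zero hw, heightRatio_chartZ, norm_inv]
    have := norm_pos_iff.2 hw
    field_simp
    ring

lemma continuous_heightRatio : Continuous heightRatio := by
  rw [OnePoint.continuous_iff]
  constructor
  · have h1 : Tendsto (fun z : ℂ => 1 - (1 + ‖z‖ ^ 2)⁻¹) (coclosedCompact ℂ) (𝓝 (1 - 0)) := by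
      refine tendsto_const_nhds.sub (tendsto_inv_atTop_zero.comp ?_)
      rw [coclosedCompact_eq_cocompact]
      exact tendsto_atTop_add_const_left _ _
        ((tendsto_pow_atTop two_ne_zero).comp tendsto_norm_cocompact_atTop)
    rw [sub_zero] at h1
    refine h1.congr fun z => ?_
    change _ = ‖z‖ ^ 2 / (1 + ‖z‖ ^ 2)
    have : (0 : ℝ) < 1 + ‖z‖ ^ 2 := by positivity
    field_simp
    ring
  · change Continuous fun z : ℂ => ‖z‖ ^ 2 / (1 + ‖z‖ ^ 2)
    exact (by fun_prop : Continuous fun z : ℂ => ‖z‖ ^ 2).div (by fun_prop) fun z => by positivity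

lemma exists_chart (x : P1) : x = chartZ 0 ∨ ∃ w, x = chartW w := by
  induction x using OnePoint.rec with
  | infty => exact Or.inr ⟨0, chartW_zero.symm⟩
  | coe z =>
    rcases eq_or_ne z 0 with rfl | hz
    · exact Or.inl rfl
    · refine Or.inr ⟨z⁻¹, ?_⟩
      rw [chartW_of_ne_zero (inv_ne_zero hz), inv_inv]
      rfl

end P1

namespace HMAE

open P1

/-- The competitor `log (|z|² / (1 + |z|²)) = -log (1 + |w|²)`. -/
noncomputable def poleCandidate (p : P1 × ℂ) : EReal :=
  ENNReal.log (ENNReal.ofReal (heightRatio p.1))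

lemma poleCandidate_chartW (w τ : ℂ) : poleCandidate (chartW w, τ) = ((-fsPotential w : ℝ) : EReal) := by
  rw [poleCandidate, heightRatio_chartW, ENNReal.log_ofReal_of_pos (by positivity), Real.log_inv]
  rfl

lemma fsPotential_add_poleCandidate_chartZ (z τ : ℂ) :
    (fsPotential z : EReal) + poleCandidate (chartZ z, τ) =
      ENNReal.log (ENNReal.ofReal (‖z‖ ^ 2)) := by
  have h : (0 : ℝ) < 1 + ‖z‖ ^ 2 := by positivity
  rw [poleCandidate, heightRatio_chartZ, fsPotential, ← ENNReal.log_ofReal_of_pos h,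
    ← ENNReal.log_mul_add, ← ENNReal.ofReal_mul h.le, mul_div_cancel₀ _ h.ne']

lemma continuous_poleCandidate : Continuous poleCandidate :=
  ENNReal.continuous_log.comp
    (ENNReal.continuous_ofReal.comp (continuous_heightRatio.comp continuous_fst))

/-- The local potentials are log|z|² and 0. -/
lemma isOmegaPsh_poleCandidate : IsOmegaPsh poleCandidate := by
  rintro κ (rfl | rfl)
  · simp only [fsPotential_add_poleCandidate_chartZ]
    have hc : Continuous fun q : ℂ × ℂ => ENNReal.log (ENNReal.ofReal (‖q.1‖ ^ 2)) :=
      ENNReal.continuous_log.comp (ENNReal.continuous_ofReal.comp (by fun_prop))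
    refine ⟨hc.upperSemicontinuous.upperSemicontinuousOn _,
      fun p _ => ENNReal.log_eq_top_iff.not.2 ENNReal.ofReal_ne_top, fun a b _ g hg hle => ?_⟩
    · exact log_sq_norm_le_circleAverage hg (b := b.1) fun ζ hζ => by simpa using hle ζ hζ
  · have h0 : ∀ q : ℂ × ℂ, (fsPotential q.1 : EReal) + poleCandidate (chartW q.1, q.2) = 0 := by
      intro q
      rw [poleCandidate_chartW, ← EReal.coe_add, add_neg_cancel, EReal.coe_zero]
    rw [show (fun q : ℂ × ℂ => (fsPotential q.1 : EReal) + poleCandidate (chartW q.1, q.2)) =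
      fun _ => 0 from funext h0]
    refine ⟨continuous_const.upperSemicontinuous.upperSemicontinuousOn _, fun p _ => EReal.zero_ne_top,
      fun a b _ g hg hle => ?_⟩
    have h := Real.circleAverage_nonneg_of_nonneg (f := g) (c := 0) (R := 1)
      (fun ζ hζ => by
        rw [abs_one] at hζ
        exact EReal.coe_nonneg.1 (hle ζ hζ))
    exact EReal.coe_nonneg.2 h

/-- The competitor depends only on |w|, so the lower bound on φ survives rotation; at z = 0 its
value is -∞. -/
lemma isCandidate_poleCandidate {φ : P1 → ℝ}
    (hge : ∀ w : ℂ, -Real.log (1 + ‖w‖ ^ 2) ≤ φ (chartW w)) :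
    IsCandidate (fun p : P1 × ℂ => φ (rot p.2 p.1)) poleCandidate := by
  refine ⟨continuous_poleCandidate.upperSemicontinuous.upperSemicontinuousOn _,
    fun p _ => ENNReal.log_eq_top_iff.not.2 ENNReal.ofReal_ne_top,
    isOmegaPsh_poleCandidate, fun z τ hτ => ?_⟩
  have hτ1 : ‖τ‖ = 1 := by simpa using hτ
  have hτ0 : τ ≠ 0 := norm_ne_zero_iff.1 (by rw [hτ1]; exact one_ne_zero)
  rcases exists_chart z with rfl | ⟨w, rfl⟩
  · simp [poleCandidate, heightRatio_chartZ]
  · rw [poleCandidate_chartW, EReal.coe_le_coe_iff]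
    have h := rot_chartW hτ1 (τ⁻¹ * w)
    rw [← mul_assoc, mul_inv_cancel₀ hτ0, one_mul] at h
    simp only [h]
    refine le_trans (le_of_eq ?_) (hge _)
    rw [fsPotential, norm_mul, norm_inv, hτ1, inv_one, one_mul]

/-- On an open set the weak solution is the competitor `-log (1 + |w|²)`. -/
lemma exists_weakSolution_eq {φ : P1 → ℝ}
    (hge : ∀ w : ℂ, -Real.log (1 + ‖w‖ ^ 2) ≤ φ (chartW w))
    (harc : IsArc {w : ℂ | φ (chartW w) = -Real.log (1 + ‖w‖ ^ 2)}) :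
    ∃ ρ R₀ : ℝ, 0 < ρ ∧ 0 < R₀ ∧ ∀ w τ : ℂ, τ ≠ 0 → ‖τ‖ < 1 → ‖w‖ + R₀ * ‖τ‖ < ρ →
      weakSolution (fun p : P1 × ℂ => φ (rot p.2 p.1)) (chartW w, τ) =
        ((-fsPotential w : ℝ) : EReal) := by
  -- The region is fixed by the arc before any competitor is chosen, so the bound passes to the
  -- supremum.
  obtain ⟨ρ, R₀, hρ, hR₀, hreg⟩ := harc.exists_nonpos_region
  refine ⟨ρ, R₀, hρ, hR₀, fun w τ hτ hτ1 hw => le_antisymm ?_ ?_⟩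
  · refine iSup₂_le fun ψ hψ => ?_
    obtain ⟨husc, htop, hpsh, hbd⟩ := hψ
    have h := hreg (fun q : ℂ × ℂ => (fsPotential q.1 : EReal) + ψ (chartW q.1, q.2)) ?_
      (hpsh chartW (Or.inr rfl)) ?_ w τ hτ hτ1 hw
    · simp only at h
      generalize ψ (chartW w, τ) = y at h
      induction y using EReal.rec with
      | bot => exact bot_le
      | top => simp at h
      | coe y =>
        rw [EReal.coe_le_coe_iff]
        have h' : fsPotential w + y ≤ 0 := by exact_mod_cast h
        linarith
    · refine UpperSemicontinuousOn.add' ?_ ?_ ?_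
      · exact (continuous_coe_real_ereal.comp
          (continuous_fsPotential.comp continuous_fst)).upperSemicontinuous.upperSemicontinuousOn _
      · exact husc.comp (g := fun q : ℂ × ℂ => (chartW q.1, q.2))
          ((continuous_chartW.comp continuous_fst).prodMk continuous_snd).continuousOn
          (fun q hq => ⟨mem_univ _, hq.2⟩)
      · intro q _
        exact EReal.continuousAt_add (Or.inl (EReal.coe_ne_top _)) (Or.inl (EReal.coe_ne_bot _))
    · intro a ha τ hτ
      have h := hbd (chartW (τ * a)) τ (by simpa using hτ)
      simp only [rot_chartW hτ] at h
      rw [ha] at h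
      refine (add_le_add_right h _).trans (le_of_eq ?_)
      rw [fsPotential_eq_of_norm_eq (show ‖τ * a‖ = ‖a‖ by rw [norm_mul, hτ, one_mul]),
        ← EReal.coe_add, fsPotential, add_neg_cancel, EReal.coe_zero]
  · rw [← poleCandidate_chartW w τ]
    exact le_iSup₂ (f := fun (ψ : P1 × ℂ → EReal)
      (_ : IsCandidate (fun p : P1 × ℂ => φ (rot p.2 p.1)) ψ) => ψ (chartW w, τ))
      poleCandidate (isCandidate_poleCandidate hge)

end HMAE

/-! ### Integration by parts for dd^c -/

/-- The second derivative of `χ` at `p` along the direction `v`. -/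
noncomputable def secondDirDeriv {E : Type*} [NormedAddCommGroup E] [NormedSpace ℝ E]
    (χ : E → ℝ) (p v : E) : ℝ :=
  fderiv ℝ (fun q => fderiv ℝ χ q v) p v

section ddc

variable {E : Type*} [NormedAddCommGroup E] [NormedSpace ℂ E]

/-- The directions 1 and i of the ζ-plane map to b and ib; in this form dd^c can be integrated by
parts. -/
lemma ddc_eq_secondDirDeriv {χ : E → ℝ} {p b : E} (h : ContDiffAt ℝ 2 χ p) :
    ddc χ p b = (1 / (4 * Real.pi)) *
      (secondDirDeriv χ p b + secondDirDeriv χ p (Complex.I • b)) := by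
  have key : ∀ m : ℂ, iteratedFDeriv ℝ 2 (fun ζ : ℂ => χ (p + ζ • b)) 0 ![m, m] =
      secondDirDeriv χ p (m • b) := by
    intro m
    set L : ℂ →L[ℝ] E := (ContinuousLinearMap.toSpanSingleton ℂ b).restrictScalars ℝ with hL
    have hLa : ∀ ζ, L ζ = ζ • b := fun ζ => rfl
    have hlin : ∀ ζ : ℂ, HasFDerivAt (fun ζ : ℂ => p + ζ • b) L ζ := fun ζ =>
      L.hasFDerivAt.const_add p
    have hp0 : p + (0 : ℂ) • b = p := by simp
    have hcont : Tendsto (fun ζ : ℂ => p + ζ • b) (𝓝 0) (𝓝 p) := by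
      have := (hlin 0).continuousAt.tendsto
      rwa [hp0] at this
    have hev : ∀ᶠ q in 𝓝 p, DifferentiableAt ℝ χ q :=
      (h.eventually (by simp)).mono fun q hq => hq.differentiableAt (by simp)
    have h1 : (fun ζ : ℂ => fderiv ℝ (fun ζ : ℂ => χ (p + ζ • b)) ζ m) =ᶠ[𝓝 0]
        fun ζ : ℂ => fderiv ℝ χ (p + ζ • b) (m • b) := by
      filter_upwards [hcont.eventually hev] with ζ hζ
      have h2 := (hζ.hasFDerivAt.comp ζ (hlin ζ)).fderiv
      rw [show (fun ζ : ℂ => χ (p + ζ • b)) = χ ∘ fun ζ : ℂ => p + ζ • b from rfl, h2]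
      rfl
    have hg : ContDiffAt ℝ 2 (fun ζ : ℂ => χ (p + ζ • b)) 0 := by
      refine ContDiffAt.comp (g := χ) (f := fun ζ : ℂ => p + ζ • b) 0 (by rwa [hp0]) ?_
      exact contDiffAt_const.add L.contDiff.contDiffAt
    have hgd : DifferentiableAt ℝ (fderiv ℝ (fun ζ : ℂ => χ (p + ζ • b))) 0 :=
      (hg.fderiv_right (m := 1) (by norm_num)).differentiableAt (by simp)
    have hχd : DifferentiableAt ℝ (fun q => fderiv ℝ χ q (m • b)) p :=
      ((h.fderiv_right (m := 1) (by norm_num)).differentiableAt (by simp)).clm_apply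
        (differentiableAt_const _)
    rw [iteratedFDeriv_two_apply]
    have h3 : fderiv ℝ (fderiv ℝ (fun ζ : ℂ => χ (p + ζ • b))) 0 m m =
        fderiv ℝ (fun ζ : ℂ => fderiv ℝ (fun ζ : ℂ => χ (p + ζ • b)) ζ m) 0 m := by
      rw [fderiv_clm_apply hgd (differentiableAt_const _)]
      simp
    simp only [Matrix.cons_val_zero, Matrix.cons_val_one]
    rw [h3, h1.fderiv_eq, secondDirDeriv]
    have hχd' : HasFDerivAt (fun q => fderiv ℝ χ q (m • b))
        (fderiv ℝ (fun q => fderiv ℝ χ q (m • b)) p) (p + (0 : ℂ) • b) := by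
      rw [hp0]; exact hχd.hasFDerivAt
    have h4 := (hχd'.comp (0 : ℂ) (hlin 0)).fderiv
    rw [show (fun ζ : ℂ => fderiv ℝ χ (p + ζ • b) (m • b)) =
      (fun q => fderiv ℝ χ q (m • b)) ∘ fun ζ : ℂ => p + ζ • b from rfl, h4]
    rfl
  rw [ddc, InnerProductSpace.laplacian_eq_iteratedFDeriv_complexPlane]
  simp only [key, one_smul]

lemma ddc_congr_nhds {χ χ' : E → ℝ} {p b : E} (h : χ =ᶠ[𝓝 p] χ') : ddc χ p b = ddc χ' p b := by
  have hc : Continuous fun ζ : ℂ => p + ζ • b := by fun_prop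
  have ht : Tendsto (fun ζ : ℂ => p + ζ • b) (𝓝 0) (𝓝 p) := by simpa using hc.tendsto 0
  have h' : (fun ζ : ℂ => χ (p + ζ • b)) =ᶠ[𝓝 0] fun ζ : ℂ => χ' (p + ζ • b) :=
    h.comp_tendsto ht
  rw [ddc, ddc, (InnerProductSpace.laplacian_congr_nhds h').eq_of_nhds]

lemma ddc_eq_zero_of_notMem_tsupport {χ : E → ℝ} {p b : E} (h : p ∉ tsupport χ) :
    ddc χ p b = 0 := by
  rw [ddc_congr_nhds (notMem_tsupport_iff_eventuallyEq.1 h)]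
  simp [ddc]

end ddc

section IntegrationByParts

/-- Nothing is known about f outside O, but the product vanishes off the closed support of g. -/
lemma continuous_mul_of_tsupport_subset {X : Type*} [TopologicalSpace X]
    {f g : X → ℝ} {O : Set X} (hO : IsOpen O)
    (hf : ContinuousOn f O) (hg : Continuous g) (hgO : tsupport g ⊆ O) :
    Continuous fun x => f x * g x :=
  continuous_of_tsupport fun _ hx =>
    (hf.continuousAt (hO.mem_nhds (hgO (tsupport_mul_subset_right hx)))).mul hg.continuousAt

lemma integrable_mul_of_tsupport_subset {X : Type*} [TopologicalSpace X]
    [MeasurableSpace X] [OpensMeasurableSpace X] {μ : Measure X} [IsFiniteMeasureOnCompacts μ]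
    {f g : X → ℝ} {O : Set X} (hO : IsOpen O)
    (hf : ContinuousOn f O) (hg : Continuous g) (hgc : HasCompactSupport g)
    (hgO : tsupport g ⊆ O) : Integrable (fun x => f x * g x) μ :=
  (continuous_mul_of_tsupport_subset hO hf hg hgO).integrable_of_hasCompactSupport hgc.mul_left

variable {E : Type*} [NormedAddCommGroup E] [NormedSpace ℝ E] [MeasurableSpace E] [BorelSpace E]
  {μ : Measure E} [μ.IsAddHaarMeasure]

lemma integrable_mul_secondDirDeriv {f χ : E → ℝ} {O : Set E} (hO : IsOpen O)
    (hf : ContinuousOn f O) (hχ : ContDiff ℝ 2 χ) (hχc : HasCompactSupport χ)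
    (hχO : tsupport χ ⊆ O) (v : E) : Integrable (fun x => f x * secondDirDeriv χ x v) μ := by
  have h1 : ContDiff ℝ 1 fun x => fderiv ℝ χ x v :=
    (hχ.fderiv_right (m := 1) (by norm_num)).clm_apply contDiff_const
  have hs := tsupport_fderiv_apply_subset (f := χ) ℝ v
  exact integrable_mul_of_tsupport_subset hO hf
    ((h1.continuous_fderiv (by simp)).clm_apply continuous_const)
    ((hχc.fderiv_apply ℝ v).fderiv_apply ℝ v)
    (((tsupport_fderiv_apply_subset ℝ v).trans hs).trans hχO)

lemma integrable_secondDirDeriv_mul {f χ : E → ℝ} {O : Set E} (hO : IsOpen O)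
    (hf : ContDiffOn ℝ 2 f O) (hχ : Continuous χ) (hχc : HasCompactSupport χ)
    (hχO : tsupport χ ⊆ O) (v : E) : Integrable (fun x => secondDirDeriv f x v * χ x) μ := by
  have h2 : ContDiffOn ℝ 1 (fun x => fderiv ℝ f x v) O :=
    (hf.fderiv_of_isOpen hO (m := 1) (by norm_num)).clm_apply contDiffOn_const
  exact integrable_mul_of_tsupport_subset hO
    ((h2.continuousOn_fderiv_of_isOpen hO le_rfl).clm_apply continuousOn_const) hχ hχc hχO

variable [FiniteDimensional ℝ E]

lemma integral_mul_fderiv_of_tsupport_subset {f g : E → ℝ} {O : Set E} (hO : IsOpen O)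
    (hf : ContDiffOn ℝ 1 f O) (hg : ContDiff ℝ 1 g) (hgc : HasCompactSupport g)
    (hgO : tsupport g ⊆ O) (v : E) :
    ∫ x, f x * fderiv ℝ g x v ∂μ = -∫ x, fderiv ℝ f x v * g x ∂μ := by
  have hf' : ContinuousOn (fun x => fderiv ℝ f x v) O :=
    (hf.continuousOn_fderiv_of_isOpen hO le_rfl).clm_apply continuousOn_const
  refine integral_mul_fderiv_eq_neg_fderiv_mul_of_integrable
    (integrable_mul_of_tsupport_subset hO hf' hg.continuous hgc hgO)
    (integrable_mul_of_tsupport_subset hO hf.continuousOn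
      ((hg.continuous_fderiv (by simp)).clm_apply continuous_const) (hgc.fderiv_apply ℝ v)
      ((tsupport_fderiv_apply_subset ℝ v).trans hgO))
    (integrable_mul_of_tsupport_subset hO hf.continuousOn hg.continuous hgc hgO) ?_ ?_
  · exact fun x hx => (hf.contDiffAt (hO.mem_nhds (hgO hx))).differentiableAt (by simp)
  · exact fun x _ => hg.contDiffAt.differentiableAt (by simp)

lemma integral_mul_secondDirDeriv {f χ : E → ℝ} {O : Set E} (hO : IsOpen O)
    (hf : ContDiffOn ℝ 2 f O) (hχ : ContDiff ℝ 2 χ) (hχc : HasCompactSupport χ)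
    (hχO : tsupport χ ⊆ O) (v : E) :
    ∫ x, f x * secondDirDeriv χ x v ∂μ = ∫ x, secondDirDeriv f x v * χ x ∂μ := by
  have h1 : ContDiff ℝ 1 fun x => fderiv ℝ χ x v :=
    (hχ.fderiv_right (m := 1) (by norm_num)).clm_apply contDiff_const
  have h2 : ContDiffOn ℝ 1 (fun x => fderiv ℝ f x v) O :=
    (hf.fderiv_of_isOpen hO (m := 1) (by norm_num)).clm_apply contDiffOn_const
  have e1 := integral_mul_fderiv_of_tsupport_subset (μ := μ) hO (hf.of_le (by norm_num)) h1
    (hχc.fderiv_apply ℝ v) ((tsupport_fderiv_apply_subset ℝ v).trans hχO) v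
  have e2 := integral_mul_fderiv_of_tsupport_subset (μ := μ) hO h2 (hχ.of_le (by norm_num)) hχc
    hχO v
  unfold secondDirDeriv
  rw [e1, e2, neg_neg]

end IntegrationByParts

/-- `dd^c` is formally self-adjoint. -/
lemma integral_mul_ddc {E : Type*} [NormedAddCommGroup E] [NormedSpace ℂ E]
    [FiniteDimensional ℝ E] [MeasurableSpace E] [BorelSpace E] {μ : Measure E}
    [μ.IsAddHaarMeasure] {f χ : E → ℝ} {O : Set E} (hO : IsOpen O)
    (hf : ContDiffOn ℝ 2 f O) (hχ : ContDiff ℝ 2 χ) (hχc : HasCompactSupport χ)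
    (hχO : tsupport χ ⊆ O) (b : E) :
    ∫ x, f x * ddc χ x b ∂μ = ∫ x, ddc f x b * χ x ∂μ := by
  have e1 : (fun x => f x * ddc χ x b) = fun x => (1 / (4 * Real.pi)) *
      (f x * secondDirDeriv χ x b + f x * secondDirDeriv χ x (Complex.I • b)) := by
    ext x
    rw [ddc_eq_secondDirDeriv hχ.contDiffAt]
    ring
  have e2 : (fun x => ddc f x b * χ x) = fun x => (1 / (4 * Real.pi)) *
      (secondDirDeriv f x b * χ x + secondDirDeriv f x (Complex.I • b) * χ x) := by
    ext x
    by_cases hx : x ∈ tsupport χ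
    · rw [ddc_eq_secondDirDeriv (hf.contDiffAt (hO.mem_nhds (hχO hx)))]
      ring
    · rw [image_eq_zero_of_notMem_tsupport hx]
      ring
  rw [e1, e2, integral_const_mul, integral_const_mul,
    integral_add (integrable_mul_secondDirDeriv hO hf.continuousOn hχ hχc hχO _)
      (integrable_mul_secondDirDeriv hO hf.continuousOn hχ hχc hχO _),
    integral_add (integrable_secondDirDeriv_mul hO hf hχ.continuous hχc hχO _)
      (integrable_secondDirDeriv_mul hO hf hχ.continuous hχc hχO _),
    integral_mul_secondDirDeriv hO hf hχ hχc hχO, integral_mul_secondDirDeriv hO hf hχ hχc hχO]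

/-! ### Explicit potentials: log|z|² and Fubini–Study -/

/-- `log |z|²` is pluriharmonic where `z ≠ 0`. -/
lemma ddc_log_norm_fst {q b : ℂ × ℂ} (hq : q.1 ≠ 0) :
    ddc (fun q : ℂ × ℂ => 2 * Real.log ‖q.1‖) q b = 0 := by
  have h1 : AnalyticAt ℂ (fun ζ : ℂ => q.1 + ζ * b.1) 0 := by fun_prop
  have h2 := (h1.harmonicAt_log_norm (by simpa using hq)).const_smul (c := (2 : ℝ))
  have h3 := h2.2.eq_of_nhds
  rw [ddc]
  simp only [Prod.fst_add, Prod.smul_fst, smul_eq_mul]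
  rw [show (fun ζ : ℂ => 2 * Real.log ‖q.1 + ζ * b.1‖) =
    (2 : ℝ) • fun ζ : ℂ => Real.log ‖q.1 + ζ * b.1‖ from rfl, h3]
  simp

lemma contDiffOn_log_norm_fst :
    ContDiffOn ℝ 2 (fun q : ℂ × ℂ => 2 * Real.log ‖q.1‖) {q | q.1 ≠ 0} := by
  intro q hq
  exact (contDiffAt_const.mul
    ((contDiffAt_fst.norm ℝ hq).log (norm_ne_zero_iff.2 hq))).contDiffWithinAt

namespace P1

lemma contDiff_fsPotential : ContDiff ℝ 2 fsPotential := by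
  unfold fsPotential
  exact (contDiff_const.add (contDiff_norm_sq ℝ)).log fun ζ => by positivity

/-- The density of the Fubini-Study form. -/
lemma ddc_fsPotential (ζ : ℂ) : ddc fsPotential ζ 1 = 1 / (Real.pi * (1 + ‖ζ‖ ^ 2) ^ 2) := by
  have hre : ∀ ζ : ℂ, HasFDerivAt (fun ζ : ℂ => ζ.re) Complex.reCLM ζ := fun ζ =>
    Complex.reCLM.hasFDerivAt
  have him : ∀ ζ : ℂ, HasFDerivAt (fun ζ : ℂ => ζ.im) Complex.imCLM ζ := fun ζ =>
    Complex.imCLM.hasFDerivAt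
  have hN : ∀ ζ : ℂ, ‖ζ‖ ^ 2 = ζ.re ^ 2 + ζ.im ^ 2 := fun ζ => by
    rw [Complex.sq_norm, Complex.normSq_apply]; ring
  have hpos : ∀ ζ : ℂ, (0 : ℝ) < 1 + (ζ.re ^ 2 + ζ.im ^ 2) := fun ζ => by positivity
  have hD : ∀ ζ : ℂ, HasFDerivAt (fun ζ : ℂ => 1 + (ζ.re ^ 2 + ζ.im ^ 2)) _ ζ := fun ζ =>
    (((hre ζ).pow 2).add ((him ζ).pow 2)).const_add 1
  have hfs : fsPotential = fun ζ : ℂ => Real.log (1 + (ζ.re ^ 2 + ζ.im ^ 2)) := by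
    ext ζ
    rw [fsPotential, hN]
  have h1 : ∀ ζ v : ℂ, fderiv ℝ fsPotential ζ v =
      2 * (ζ.re * v.re + ζ.im * v.im) / (1 + (ζ.re ^ 2 + ζ.im ^ 2)) := by
    intro ζ v
    rw [hfs, ((hD ζ).log (hpos ζ).ne').fderiv]
    simp
    field_simp
  have h2 : ∀ ζ v : ℂ, secondDirDeriv fsPotential ζ v =
      (2 * (v.re ^ 2 + v.im ^ 2) * (1 + (ζ.re ^ 2 + ζ.im ^ 2)) -
        (2 * (ζ.re * v.re + ζ.im * v.im)) ^ 2) / (1 + (ζ.re ^ 2 + ζ.im ^ 2)) ^ 2 := by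
    intro ζ v
    unfold secondDirDeriv
    have hn : HasFDerivAt (fun ζ : ℂ => 2 * (ζ.re * v.re + ζ.im * v.im)) _ ζ :=
      (((hre ζ).mul_const v.re).add ((him ζ).mul_const v.im)).const_mul 2
    have hq := hn.mul ((hasDerivAt_inv (hpos ζ).ne').comp_hasFDerivAt ζ (hD ζ))
    have he : (fun q => fderiv ℝ fsPotential q v) = (fun ζ : ℂ => 2 * (ζ.re * v.re + ζ.im * v.im)) *
        (Inv.inv ∘ fun ζ : ℂ => 1 + (ζ.re ^ 2 + ζ.im ^ 2)) := funext fun q => h1 q v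
    rw [he, hq.fderiv]
    simp
    field_simp
    ring
  rw [ddc_eq_secondDirDeriv contDiff_fsPotential.contDiffAt, h2, h2, hN]
  have := hpos ζ
  have := Real.pi_pos
  simp
  field_simp
  ring

end P1

/-! ### Vanishing currents and loss of strict positivity -/

namespace HMAE

open P1

/-- If, on the open set `S` and in each chart, `log (1 + |ζ|²) + Φ` is a smooth function `v` with
`dd^c v = 0`, then the current `π^* ω_FS + dd^c Φ` vanishes on `S`. -/
lemma currentVanishesOn_of_eqOn {Φ : P1 × ℂ → EReal} {S : Set (P1 × ℂ)} (hS : IsOpen S)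
    (h : ∀ κ ∈ charts, ∃ v : ℂ × ℂ → ℝ, ContDiffOn ℝ 2 v {q | (κ q.1, q.2) ∈ S} ∧
      (∀ q : ℂ × ℂ, (κ q.1, q.2) ∈ S →
        Φ (κ q.1, q.2) = ((v q - fsPotential q.1 : ℝ) : EReal)) ∧
      ∀ q b : ℂ × ℂ, (κ q.1, q.2) ∈ S → ddc v q b = 0) :
    CurrentVanishesOn Φ S := by
  intro κ hκ
  obtain ⟨v, hv, hΦ, hddc⟩ := h κ hκ
  have hκc : Continuous κ := by
    rcases hκ with rfl | rfl
    · exact continuous_chartZ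
    · exact continuous_chartW
  have hO : IsOpen {q : ℂ × ℂ | (κ q.1, q.2) ∈ S} :=
    hS.preimage ((hκc.comp continuous_fst).prodMk continuous_snd)
  have hval : ∀ q : ℂ × ℂ, (κ q.1, q.2) ∈ S →
      fsPotential q.1 + (Φ (κ q.1, q.2)).toReal = v q := by
    intro q hq
    rw [hΦ q hq, EReal.toReal_coe]
    ring
  refine ⟨Eventually.of_forall fun q hq => ?_, ?_, fun χ hχ hχc hχS b => ?_⟩
  · rw [hΦ q hq]
    exact ⟨EReal.coe_ne_top _, EReal.coe_ne_bot _⟩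
  · exact ContinuousOn.locallyIntegrableOn (hv.continuousOn.congr hval) hO.measurableSet
  · have e : (fun q : ℂ × ℂ => (fsPotential q.1 + (Φ (κ q.1, q.2)).toReal) * ddc χ q b) =
        fun q => v q * ddc χ q b := by
      ext q
      by_cases hq : q ∈ tsupport χ
      · rw [hval q (hχS hq)]
      · rw [ddc_eq_zero_of_notMem_tsupport hq, mul_zero, mul_zero]
    have : (volume : Measure (ℂ × ℂ)).IsAddHaarMeasure := by
      rw [Measure.volume_eq_prod]
      infer_instance
    rw [e, integral_mul_ddc hO hv (by exact_mod_cast contDiff_infty.1 hχ 2) hχc hχS b]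
    refine integral_eq_zero_of_ae (Eventually.of_forall fun q => ?_)
    by_cases hq : q ∈ tsupport χ
    · simp [hddc q b (hχS hq)]
    · simp [image_eq_zero_of_notMem_tsupport hq]

/-- The current `ω_FS + dd^c h` is not strictly positive if `h = -log (1 + |w|²)` near `w = 0`. -/
lemma not_strictlyPositive_of_eq {h : P1 → EReal} {c : ℝ} (hc : 0 < c)
    (hh : ∀ w : ℂ, ‖w‖ < c → h (chartW w) = ((-fsPotential w : ℝ) : EReal)) :
    ¬ StrictlyPositive h := by
  rintro ⟨ε, hε, hpos⟩
  set χ : ContDiffBump (0 : ℂ) := ⟨c / 4, c / 2, by positivity, by linarith⟩ with hχ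
  have h1 := hpos chartW (Or.inr rfl) χ χ.contDiff χ.hasCompactSupport fun ζ => χ.nonneg
  have hsupp : ∀ ζ ∈ tsupport χ, ‖ζ‖ < c := by
    intro ζ hζ
    rw [χ.tsupport_eq, mem_closedBall_zero_iff] at hζ
    have : χ.rOut = c / 2 := rfl
    linarith
  -- On the support of the bump the potential is -ε times that of ω_FS, so the test gives -ε∫χ ω_FS
  -- < 0.
  have e : (fun ζ : ℂ => ((1 - ε) * fsPotential ζ + (h (chartW ζ)).toReal) * ddc χ ζ 1) =
      fun ζ => -ε * (fsPotential ζ * ddc χ ζ 1) := by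
    ext ζ
    by_cases hζ : ζ ∈ tsupport χ
    · rw [hh ζ (hsupp ζ hζ), EReal.toReal_coe]
      ring
    · rw [ddc_eq_zero_of_notMem_tsupport hζ, mul_zero, mul_zero, mul_zero]
  rw [e, integral_const_mul, integral_mul_ddc isOpen_univ contDiff_fsPotential.contDiffOn
    χ.contDiff χ.hasCompactSupport (subset_univ _)] at h1
  have hden : ∀ ζ : ℂ, 0 < Real.pi * (1 + ‖ζ‖ ^ 2) ^ 2 := fun ζ => by
    have := Real.pi_pos
    positivity
  have h2 : 0 < ∫ ζ : ℂ, ddc fsPotential ζ 1 * χ ζ := by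
    simp only [ddc_fsPotential]
    refine Continuous.integral_pos_of_hasCompactSupport_nonneg_nonzero (x := 0) ?_
      χ.hasCompactSupport.mul_left
      (fun ζ => mul_nonneg (one_div_nonneg.2 (hden ζ).le) χ.nonneg) ?_
    · exact (continuous_const.div (by fun_prop) fun ζ => (hden ζ).ne').mul χ.continuous
    · have hχ0 : χ 0 = 1 := χ.one_of_mem_closedBall (mem_closedBall_self χ.rIn_pos.le)
      rw [hχ0, mul_one]
      exact (one_div_pos.2 (hden 0)).ne'
  nlinarith

end HMAE

/-! ### Conclusion -/

theorem theorem2p1 (φ : P1 → ℝ) (hφ : P1.Smooth φ) (hpos : HMAE.IsKahlerPotential φ)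
    (hge : ∀ w : ℂ, -Real.log (1 + ‖w‖ ^ 2) ≤ φ (P1.chartW w))
    (harc : IsArc {w : ℂ | φ (P1.chartW w) = -Real.log (1 + ‖w‖ ^ 2)}) :
    ¬ HMAE.HasMaximalRank
        (HMAE.weakSolution (fun p : P1 × ℂ => φ (P1.rot p.2 p.1))) ∧
      ∃ S : Set (P1 × ℂ), IsOpen S ∧ S.Nonempty ∧ S ⊆ Set.univ ×ˢ Metric.ball (0 : ℂ) 1 ∧
        HMAE.CurrentVanishesOn
          (HMAE.weakSolution (fun p : P1 × ℂ => φ (P1.rot p.2 p.1))) S := by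
  obtain ⟨ρ, R₀, hρ, hR₀, hΦ⟩ := HMAE.exists_weakSolution_eq hge harc
  -- Half of ρ is allotted to ‖w‖ and half to R₀‖τ‖, so that the region contains a product.
  set c := ρ / 2 with hc
  have hc0 : 0 < c := by positivity
  obtain ⟨t, ht0, ht⟩ := exists_between (lt_min one_pos (div_pos hc0 hR₀))
  obtain ⟨ht1, htc⟩ := lt_min_iff.1 ht
  rw [lt_div_iff₀ hR₀] at htc
  have htn : ‖(t : ℂ)‖ = t := by rw [Complex.norm_real, Real.norm_of_nonneg ht0.le]
  have ht0' : (t : ℂ) ≠ 0 := by exact_mod_cast ht0.ne'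
  -- As `heightRatio` is 1/(1+|w|²), the last condition means |w| < c without reference to a chart.
  -- It also excludes z = 0, the pole of log|z|².
  have hS : IsOpen {p : P1 × ℂ | p.2 ≠ 0 ∧ ‖p.2‖ < 1 ∧ R₀ * ‖p.2‖ < c ∧
      (1 + c ^ 2)⁻¹ < P1.heightRatio p.1} := by
    have h1 : Continuous fun p : P1 × ℂ => P1.heightRatio p.1 :=
      P1.continuous_heightRatio.comp continuous_fst
    have h2 : Continuous fun p : P1 × ℂ => ‖p.2‖ := continuous_snd.norm
    exact (isOpen_ne_fun continuous_snd continuous_const).and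
      ((isOpen_lt h2 continuous_const).and
        ((isOpen_lt (continuous_const.mul h2) continuous_const).and
          (isOpen_lt continuous_const h1)))
  refine ⟨fun hmax => ?_, {p : P1 × ℂ | p.2 ≠ 0 ∧ ‖p.2‖ < 1 ∧ R₀ * ‖p.2‖ < c ∧
    (1 + c ^ 2)⁻¹ < P1.heightRatio p.1}, ?_, ?_, ?_, ?_⟩
  -- Maximal rank already fails on the slice τ = t.
  · refine HMAE.not_strictlyPositive_of_eq hc0 (fun w hw => ?_)
      (hmax t (by rw [mem_closedBall_zero_iff, htn]; exact ht1.le))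
    refine hΦ w t ht0' (by rwa [htn]) ?_
    rw [htn]
    linarith
  · exact hS
  · refine ⟨(P1.chartW 0, t), ht0', by simpa only [htn] using ht1, by simp only [htn]; linarith, ?_⟩
    rw [P1.heightRatio_chartW]
    apply inv_strictAnti₀ (by simp)
    simp only [norm_zero]
    nlinarith
  · exact fun p hp => ⟨mem_univ _, by simpa using hp.2.1⟩
  have hW : ∀ w τ : ℂ, τ ≠ 0 → ‖τ‖ < 1 → R₀ * ‖τ‖ < c →
      (1 + c ^ 2)⁻¹ < P1.heightRatio (P1.chartW w) →
      HMAE.weakSolution (fun p : P1 × ℂ => φ (P1.rot p.2 p.1)) (P1.chartW w, τ) =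
        ((-P1.fsPotential w : ℝ) : EReal) := by
    intro w τ hτ hτ1 hτc hw
    rw [P1.heightRatio_chartW, inv_lt_inv₀ (by positivity) (by positivity)] at hw
    have hwc : ‖w‖ < c := lt_of_pow_lt_pow_left₀ 2 hc0.le (by linarith)
    exact hΦ w τ hτ hτ1 (by linarith)
  have hZ0 : ∀ z : ℂ, (1 + c ^ 2)⁻¹ < P1.heightRatio (P1.chartZ z) → z ≠ 0 := by
    rintro z hz rfl
    have : (0 : ℝ) < (1 + c ^ 2)⁻¹ := by positivity
    rw [P1.heightRatio_chartZ] at hz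
    rw [norm_zero, zero_pow two_ne_zero, zero_div] at hz
    exact absurd hz (not_lt.2 this.le)
  refine HMAE.currentVanishesOn_of_eqOn hS ?_
  rintro κ (rfl | rfl)
  · refine ⟨fun q => 2 * Real.log ‖q.1‖, contDiffOn_log_norm_fst.mono fun q hq => hZ0 _ hq.2.2.2,
      ?_, fun q b hq => ddc_log_norm_fst (hZ0 _ hq.2.2.2)⟩
    rintro ⟨z, τ⟩ ⟨h1, h2, h3, h4⟩
    have hz : z ≠ 0 := hZ0 z h4
    have hzn : 0 < ‖z‖ := norm_pos_iff.2 hz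
    have e : P1.chartZ z = P1.chartW z⁻¹ := by
      rw [P1.chartW_of_ne_zero (inv_ne_zero hz), inv_inv]
    simp only [e] at h4 ⊢
    rw [hW z⁻¹ τ h1 h2 h3 h4, EReal.coe_eq_coe_iff, P1.fsPotential, P1.fsPotential, norm_inv]
    have h5 : 1 + ‖z‖ ^ 2 = ‖z‖ ^ 2 * (1 + ‖z‖⁻¹ ^ 2) := by field_simp; ring
    rw [h5, Real.log_mul (by positivity) (by positivity), Real.log_pow]
    push_cast
    ring
  · refine ⟨fun _ => 0, contDiffOn_const, ?_, fun q b _ => by simp [ddc]⟩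
    rintro ⟨w, τ⟩ ⟨h1, h2, h3, h4⟩
    rw [hW w τ h1 h2 h3 h4, zero_sub]
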